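/- Let $\bar G$ be a compact connected Lie group with Lie algebra $\bar{\mathfrak g}$, let $G\subset\bar G$ be a closed subgroup with Lie algebra $\mathfrak g$, and fix an $\mathrm{Ad}(G)$-invariant decomposition $\bar{\mathfrak g}=\mathfrak g\oplus\mathfrak m$. Let $\pi:\bar P\to M$ be a smooth principal $\bar G$-bundle over a smooth manifold $M$, with connection form $\bar\omega:T\bar P\to\bar{\mathfrak g}$ and horizontal distribution $\bar H=\ker\bar\omega$. For $\bar p\in\bar P$ let $\sigma_{\bar p}(b)$ be the value at $\bar p$ of the fundamental vector field of $b\in\bar{\mathfrak g}$, and put $\widetilde\omega_{\bar p}(\bar X)=\sigma_{\bar p}(\bar\omega_{\bar p}(\bar X))$ for $\bar X\in T_{\bar p}\bar P$. Let $E=\bar P/G$, let $\pi_G:\bar P\to E$ and $\pi_E:E\to M$ be the projections, let $VE=\ker d\pi_E$, and let $HE=d\pi_G(\bar H)$. Let $\omega_E$ be the induced connection form on $E$, given by $\omega_E(d\pi_G(\bar X))=d\pi_G(\widetilde\omega(\bar X))$. For $x\in M$ let $E_x=\pi_E^{-1}(x)$ with inclusion $i_x:E_x\to E$. Each $\bar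 p\in\pi^{-1}(x)$ (for example the value $s(x)$ of a local section $s$ of $\bar P$, which gives a chart of $E$) gives an identification $\eta_x:E_x\to\bar G/G$, $\eta_x(\pi_G(\bar p\bar g))=[\bar g]$. Let $a\in H^1(\bar G/G;\mathbb R)$ be a de Rham class, let $\xi$ be a closed $\bar G$-invariant $1$-form on $\bar G/G$ with $[\xi]=a$, and let $\xi_0:\mathfrak m\to\mathbb R$ be its value at $[e]$. Let $\widetilde\alpha$ be the function on $VE$ given by $\widetilde\alpha(d\pi_G(\sigma_{\bar p}(b)))=\xi_0(b)$ for $\bar p\in\bar P$, $b\in\mathfrak m$. Then $\omega_E$ and $\widetilde\alpha$ are well defined, and $\alpha(X)=\widetilde\alpha(\omega_E(X))$ is a smooth $1$-form on $E$ with the following properties. 1. $\alpha$ vanishes on the horizontal distribution $HE$. 2. For each $x\in M$ the form $i_x^*\alpha$ on $E_x$ is closed, and for each identification $\eta_x$ as above, $\eta_x$ is a diffeomorphism, $i_x^*\alpha=\eta_x^*\xi$, and hence $[i_x^*\alpha]=H^1(\eta_x)a$ in $H^1(E_x;\mathbb R)$. -/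

import Mathlib

open scoped Manifold ContDiff Bundle RightActions
open Bundle

namespace HGB
noncomputable section

section Forms
variable {E : Type*} [NormedAddCommGroup E] [NormedSpace ℝ E]
  {M : Type*} [TopologicalSpace M] [ChartedSpace E M] [IsManifold 𝓘(ℝ, E) ∞ M]
  {E' : Type*} [NormedAddCommGroup E'] [NormedSpace ℝ E']
  {N : Type*} [TopologicalSpace N] [ChartedSpace E' N] [IsManifold 𝓘(ℝ, E') ∞ N]
  {V : Type*} [NormedAddCommGroup V] [NormedSpace ℝ V]

/-- Smooth `V`-valued differential 1-forms on the manifold `M` (without boundary, modelled on `E`):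
smooth sections of the bundle `Hom(TM, M × V)`. -/
abbrev OneForm (E : Type*) [NormedAddCommGroup E] [NormedSpace ℝ E]
    (M : Type*) [TopologicalSpace M] [ChartedSpace E M] [IsManifold 𝓘(ℝ, E) ∞ M]
    (V : Type*) [NormedAddCommGroup V] [NormedSpace ℝ V] : Type _ :=
  Cₛ^∞⟮𝓘(ℝ, E); E →L[ℝ] V, fun x : M => TangentSpace 𝓘(ℝ, E) x →L[ℝ] Trivial M V x⟯

/-- The expression of a 1-form in the preferred chart `φ` at `x`: the pullback of `β` by `φ⁻¹`. -/
def localRep (β : OneForm E M V) (x : M) (z : E) : E →L[ℝ] V :=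
  (β ((extChartAt 𝓘(ℝ, E) x).symm z)).comp
    (mfderiv 𝓘(ℝ, E) 𝓘(ℝ, E) (extChartAt 𝓘(ℝ, E) x).symm z)

theorem localRep_eq_inCoordinates (β : OneForm E M V) (x : M) {z : E}
    (hz : z ∈ (extChartAt 𝓘(ℝ, E) x).target) :
    localRep β x z = ContinuousLinearMap.inCoordinates E (TangentSpace 𝓘(ℝ, E)) V (Trivial M V)
      x ((extChartAt 𝓘(ℝ, E) x).symm z) x ((extChartAt 𝓘(ℝ, E) x).symm z)
      (β ((extChartAt 𝓘(ℝ, E) x).symm z)) := by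
  have h1 : (extChartAt 𝓘(ℝ, E) x).symm z ∈ (chartAt E x).source := by
    have := (extChartAt 𝓘(ℝ, E) x).map_target hz
    rwa [extChartAt_source] at this
  ext v
  simp only [localRep, ContinuousLinearMap.inCoordinates]
  have := TangentBundle.symmL_trivializationAt (I := 𝓘(ℝ, E)) h1
  rw [this, (extChartAt 𝓘(ℝ, E) x).right_inv hz]
  simp [mfderivWithin_univ]

theorem contDiffAt_localRep (β : OneForm E M V) (x : M) :
    ContDiffAt ℝ ∞ (localRep β x) (extChartAt 𝓘(ℝ, E) x x) := by
  have h := ((contMDiffAt_hom_bundle _).1 (β.contMDiff x)).2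
  have hs : ContMDiffAt 𝓘(ℝ, E) 𝓘(ℝ, E) ∞ (extChartAt 𝓘(ℝ, E) x).symm
      (extChartAt 𝓘(ℝ, E) x x) :=
    (contMDiffOn_extChartAt_symm x).contMDiffAt (extChartAt_target_mem_nhds x)
  rw [← contMDiffAt_iff_contDiffAt]
  refine (ContMDiffAt.comp_of_eq (g := fun y => ContinuousLinearMap.inCoordinates E
    (TangentSpace 𝓘(ℝ, E)) V (Trivial M V) x y x y (β y)) h hs
    (extChartAt_to_inv x)).congr_of_eventuallyEq ?_
  filter_upwards [extChartAt_target_mem_nhds (I := 𝓘(ℝ, E)) x] with z hz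
  exact localRep_eq_inCoordinates β x hz

/-- The exterior derivative of a 1-form at `x`, computed in the preferred chart `φ` at `x`, which
identifies `TₓM` with `E`: `dβ(u, v) = (D_u β)(v) - (D_v β)(u)`. -/
def extD (β : OneForm E M V) (x : M) (u v : E) : V :=
  fderiv ℝ (localRep β x) (extChartAt 𝓘(ℝ, E) x x) u v -
    fderiv ℝ (localRep β x) (extChartAt 𝓘(ℝ, E) x x) v u

theorem localRep_add (β γ : OneForm E M V) (x : M) :
    localRep (β + γ) x = localRep β x + localRep γ x := by
  ext z v; rfl

theorem localRep_smul (c : ℝ) (β : OneForm E M V) (x : M) :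
    localRep (c • β) x = c • localRep β x := by
  ext z v; rfl

theorem differentiableAt_localRep (β : OneForm E M V) (x : M) :
    DifferentiableAt ℝ (localRep β x) (extChartAt 𝓘(ℝ, E) x x) :=
  (contDiffAt_localRep β x).differentiableAt (by simp)

variable (E M) in
/-- The closed real 1-forms. -/
def closedForms : Submodule ℝ (OneForm E M ℝ) where
  carrier := {β | ∀ x u v, extD β x u v = 0}
  zero_mem' := by
    intro x u v
    have : localRep (0 : OneForm E M ℝ) x = 0 := by ext z v; rfl
    simp [extD, this]
  add_mem' := by
    intro β γ hβ hγ x u v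
    have h1 := hβ x u v
    have h2 := hγ x u v
    simp only [extD] at h1 h2 ⊢
    rw [localRep_add, fderiv_add (differentiableAt_localRep β x) (differentiableAt_localRep γ x)]
    simp only [add_apply]
    linarith
  smul_mem' := by
    intro c β hβ x u v
    have h1 := hβ x u v
    simp only [extD] at h1 ⊢
    rw [localRep_smul, fderiv_const_smul (differentiableAt_localRep β x)]
    simp only [smul_apply, ← smul_sub, h1, smul_zero]

variable (E M) in
/-- The exact real 1-forms: the differentials of smooth functions. -/
def exactForms : Submodule ℝ (OneForm E M ℝ) where
  carrier := {β | ∃ f : M → ℝ, ContMDiff 𝓘(ℝ, E) 𝓘(ℝ, ℝ) ∞ f ∧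
    ∀ x, β x = mfderiv 𝓘(ℝ, E) 𝓘(ℝ, ℝ) f x}
  zero_mem' := ⟨fun _ => 0, contMDiff_const, fun x => by
    rw [mfderiv_const]; rfl⟩
  add_mem' := by
    rintro β γ ⟨f, hf, hβ⟩ ⟨g, hg, hγ⟩
    refine ⟨f + g, hf.add hg, fun x => ?_⟩
    rw [mfderiv_add (hf.mdifferentiable (by simp) x) (hg.mdifferentiable (by simp) x), ← hβ, ← hγ]
    rfl
  smul_mem' := by
    rintro c β ⟨f, hf, hβ⟩
    refine ⟨c • f, ContMDiff.smul (I := 𝓘(ℝ, ℝ)) (f := fun _ => c) contMDiff_const hf, fun x => ?_⟩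
    rw [const_smul_mfderiv (hf.mdifferentiable (by simp) x), ← hβ]
    rfl

variable (E M) in
/-- The first de Rham cohomology space `H¹(M)`: closed 1-forms modulo exact 1-forms. -/
abbrev H1 : Type _ :=
  closedForms E M ⧸ (exactForms E M).comap (closedForms E M).subtype

theorem contMDiff_pullback {f : M → N} (hf : ContMDiff 𝓘(ℝ, E) 𝓘(ℝ, E') ∞ f)
    (β : OneForm E' N V) :
    ContMDiff 𝓘(ℝ, E) (𝓘(ℝ, E).prod 𝓘(ℝ, E →L[ℝ] V)) ∞ fun x =>
      TotalSpace.mk' (E →L[ℝ] V)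
        (E := fun x : M => TangentSpace 𝓘(ℝ, E) x →L[ℝ] Trivial M V x) x
        ((β (f x)).comp (mfderiv 𝓘(ℝ, E) 𝓘(ℝ, E') f x)) := by
  intro x
  rw [contMDiffAt_hom_bundle]
  refine ⟨contMDiffAt_id, ?_⟩
  have h1 := (((contMDiffAt_hom_bundle _).1 (β.contMDiff (f x))).2).comp x hf.contMDiffAt
  have h2 := (hf.contMDiffAt (x := x)).mfderiv_const (m := ∞) (by simp)
  refine (ContMDiffAt.clm_comp h1 h2).congr_of_eventuallyEq ?_
  have hN : ∀ᶠ y in nhds x, f y ∈ (trivializationAt E' (TangentSpace 𝓘(ℝ, E')) (f x)).baseSet :=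
    hf.continuous.continuousAt.eventually
      ((trivializationAt E' (TangentSpace 𝓘(ℝ, E')) (f x)).open_baseSet.mem_nhds
        (FiberBundle.mem_baseSet_trivializationAt' (f x)))
  filter_upwards [hN] with y hy
  ext v
  simp only [ContinuousLinearMap.inCoordinates, inTangentCoordinates, Function.comp_apply, id_eq,
    ContinuousLinearMap.comp_apply, Trivialization.continuousLinearMapAt_apply]
  rw [← Trivialization.continuousLinearMapAt_apply (R := ℝ) (trivializationAt E' _ (f x)),
    Trivialization.symmL_continuousLinearMapAt _ hy]
  simp

/-- The pullback `f^*` of 1-forms by a smooth map. -/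
def pullback (f : C^∞⟮𝓘(ℝ, E), M; 𝓘(ℝ, E'), N⟯) : OneForm E' N V →ₗ[ℝ] OneForm E M V where
  toFun β := ⟨fun x => (β (f x)).comp (mfderiv 𝓘(ℝ, E) 𝓘(ℝ, E') f x),
    contMDiff_pullback f.contMDiff β⟩
  map_add' β γ := by ext x v; rfl
  map_smul' c β := by ext x v; rfl

theorem localRep_pullback (f : C^∞⟮𝓘(ℝ, E), M; 𝓘(ℝ, E'), N⟯) (β : OneForm E' N V) (x : M) :
    localRep (pullback f β) x =ᶠ[nhds (extChartAt 𝓘(ℝ, E) x x)] fun z =>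
      (localRep β (f x) (writtenInExtChartAt 𝓘(ℝ, E) 𝓘(ℝ, E') x f z)).comp
        (fderiv ℝ (writtenInExtChartAt 𝓘(ℝ, E) 𝓘(ℝ, E') x f) z) := by
  have hc : ContinuousAt (f ∘ (extChartAt 𝓘(ℝ, E) x).symm) (extChartAt 𝓘(ℝ, E) x x) :=
    f.contMDiff.continuous.continuousAt.comp (continuousAt_extChartAt_symm x)
  have hN : (extChartAt 𝓘(ℝ, E') (f x)).source ∈
      nhds ((f ∘ (extChartAt 𝓘(ℝ, E) x).symm) (extChartAt 𝓘(ℝ, E) x x)) := by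
    simp only [Function.comp_apply, extChartAt_to_inv]
    exact extChartAt_source_mem_nhds (f x)
  filter_upwards [extChartAt_target_mem_nhds (I := 𝓘(ℝ, E)) x, hc.eventually_mem hN] with z hz hfz
  set φ := extChartAt 𝓘(ℝ, E) x
  set χ := extChartAt 𝓘(ℝ, E') (f x)
  have hφ : MDifferentiableAt 𝓘(ℝ, E) 𝓘(ℝ, E) φ.symm z :=
    ((contMDiffOn_extChartAt_symm (n := ∞) x).contMDiffAt
      ((isOpen_extChartAt_target x).mem_nhds hz)).mdifferentiableAt (by simp)
  have hχ : MDifferentiableAt 𝓘(ℝ, E') 𝓘(ℝ, E') χ (f (φ.symm z)) :=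
    mdifferentiableAt_extChartAt (by rwa [extChartAt_source] at hfz)
  have hf : MDifferentiableAt 𝓘(ℝ, E) 𝓘(ℝ, E') f (φ.symm z) :=
    f.contMDiff.mdifferentiable (by simp) _
  have hχs : MDifferentiableAt 𝓘(ℝ, E') 𝓘(ℝ, E') χ.symm (χ (f (φ.symm z))) :=
    ((contMDiffOn_extChartAt_symm (n := ∞) (f x)).contMDiffAt
      ((isOpen_extChartAt_target (f x)).mem_nhds (χ.map_source hfz))).mdifferentiableAt (by simp)
  have e1 : fderiv ℝ (writtenInExtChartAt 𝓘(ℝ, E) 𝓘(ℝ, E') x f) z =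
      (mfderiv 𝓘(ℝ, E') 𝓘(ℝ, E') χ (f (φ.symm z))).comp
        ((mfderiv 𝓘(ℝ, E) 𝓘(ℝ, E') f (φ.symm z)).comp
          (mfderiv 𝓘(ℝ, E) 𝓘(ℝ, E) φ.symm z)) := by
    have h := HasMFDerivAt.comp z (g := χ) hχ.hasMFDerivAt
      (hf.hasMFDerivAt.comp z hφ.hasMFDerivAt)
    rw [← mfderiv_eq_fderiv]
    exact h.mfderiv
  have e2 : (mfderiv 𝓘(ℝ, E') 𝓘(ℝ, E') χ.symm (χ (f (φ.symm z)))).comp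
      (mfderiv 𝓘(ℝ, E') 𝓘(ℝ, E') χ (f (φ.symm z))) = ContinuousLinearMap.id ℝ _ := by
    rw [← mfderiv_comp _ hχs hχ, ← mfderiv_id]
    apply Filter.EventuallyEq.mfderiv_eq
    filter_upwards [(isOpen_extChartAt_source (I := 𝓘(ℝ, E')) (f x)).mem_nhds hfz] with y hy
    exact χ.left_inv hy
  have e3 : ∀ (y y' : N) (_ : y = y') (w : E'),
      (β y : E' →L[ℝ] V) w = (β y' : E' →L[ℝ] V) w := by rintro y _ rfl w; rfl
  rw [e1]
  ext v
  have e4 := DFunLike.congr_fun e2 (mfderiv 𝓘(ℝ, E) 𝓘(ℝ, E') f (φ.symm z)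
    (mfderiv 𝓘(ℝ, E) 𝓘(ℝ, E) φ.symm z v))
  refine (congrArg (β (f (φ.symm z))) e4.symm).trans ?_
  exact e3 _ _ (χ.left_inv hfz).symm _

theorem pullback_mem_closedForms (f : C^∞⟮𝓘(ℝ, E), M; 𝓘(ℝ, E'), N⟯) {β : OneForm E' N ℝ}
    (hβ : β ∈ closedForms E' N) : pullback f β ∈ closedForms E M := by
  intro x u v
  set F := writtenInExtChartAt 𝓘(ℝ, E) 𝓘(ℝ, E') x f with hF
  set z := extChartAt 𝓘(ℝ, E) x x with hz
  have hFz : F z = extChartAt 𝓘(ℝ, E') (f x) (f x) := by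
    simp [hF, hz, writtenInExtChartAt]
  have hs : ContDiffAt ℝ ∞ F z := by
    have := (contMDiffAt_iff (x := x)).1 f.contMDiff.contMDiffAt
    have h := this.2
    rwa [ModelWithCorners.range_eq_univ, contDiffWithinAt_univ] at h
  have hd : HasFDerivAt F (fderiv ℝ F z) z := (hs.differentiableAt (by simp)).hasFDerivAt
  have hd2 : HasFDerivAt (fderiv ℝ F) (fderiv ℝ (fderiv ℝ F) z) z :=
    ((hs.fderiv_right (m := 1) (WithTop.coe_le_coe.2 le_top)).differentiableAt
      (by simp)).hasFDerivAt
  have hl : HasFDerivAt (localRep β (f x)) (fderiv ℝ (localRep β (f x)) (F z)) (F z) := by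
    rw [hFz]; exact (differentiableAt_localRep β (f x)).hasFDerivAt
  have hsymm : fderiv ℝ (fderiv ℝ F) z u v = fderiv ℝ (fderiv ℝ F) z v u :=
    hs.isSymmSndFDerivAt (by
      rw [minSmoothness_of_isRCLikeNormedField]; exact WithTop.coe_le_coe.2 (le_top (α := ℕ∞))) u v
  have hc := ((hl.comp z hd).clm_comp hd2).congr_of_eventuallyEq (localRep_pullback f β x)
  have hβ' := hβ (f x) (fderiv ℝ F z u) (fderiv ℝ F z v)
  simp only [extD] at hβ' ⊢
  rw [hc.fderiv]
  rw [← hFz] at hβ'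
  simpa [hsymm] using hβ'

theorem pullback_mem_exactForms (f : C^∞⟮𝓘(ℝ, E), M; 𝓘(ℝ, E'), N⟯) {β : OneForm E' N ℝ}
    (hβ : β ∈ exactForms E' N) : pullback f β ∈ exactForms E M := by
  obtain ⟨g, hg, h⟩ := hβ
  refine ⟨g ∘ f, hg.comp f.contMDiff, fun x => ?_⟩
  rw [mfderiv_comp x (hg.mdifferentiable (by simp) _) (f.contMDiff.mdifferentiable (by simp) x),
    ← h]
  rfl

/-- The linear map `H¹(f) : H¹(N) → H¹(M)` induced by a smooth map `f : M → N`. -/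
def H1.map (f : C^∞⟮𝓘(ℝ, E), M; 𝓘(ℝ, E'), N⟯) : H1 E' N →ₗ[ℝ] H1 E M :=
  Submodule.mapQ _ _
    ((pullback f).restrict fun _ hβ => pullback_mem_closedForms f hβ)
    fun _ hβ => pullback_mem_exactForms f hβ

/-- The de Rham class of a closed 1-form. -/
def H1.mk (β : OneForm E M ℝ) (hβ : β ∈ closedForms E M) : H1 E M :=
  Submodule.Quotient.mk ⟨β, hβ⟩
end Forms

section Group

variable {EK : Type*} [NormedAddCommGroup EK] [NormedSpace ℝ EK]
  {K : Type*} [TopologicalSpace K] [ChartedSpace EK K] [Group K] [LieGroup 𝓘(ℝ, EK) ∞ K]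

variable (EK) in
/-- The adjoint action of `g` on the Lie algebra `T₁K`: the differential at `1` of
`k ↦ g k g⁻¹`. -/
def Ad (g : K) (v : GroupLieAlgebra 𝓘(ℝ, EK) K) : GroupLieAlgebra 𝓘(ℝ, EK) K :=
  mfderiv 𝓘(ℝ, EK) 𝓘(ℝ, EK) (fun k : K => g * k * g⁻¹) 1 v

variable (EK) in
/-- The Lie algebra of a closed subgroup `Γ` of the Lie group `K`, as a subspace of `T₁K`: the
velocities at `1` of the smooth curves of `K` that pass through `1` at time `0` and stay in `Γ`. -/
def lieAlgebraOf (Γ : Subgroup K) : Submodule ℝ (GroupLieAlgebra 𝓘(ℝ, EK) K) where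
  carrier := {v | ∃ c : ℝ → K, ContMDiff 𝓘(ℝ, ℝ) 𝓘(ℝ, EK) ∞ c ∧ c 0 = 1 ∧ (∀ t, c t ∈ Γ) ∧
    (mfderiv 𝓘(ℝ, ℝ) 𝓘(ℝ, EK) c 0 (1 : ℝ) : EK) = v}
  zero_mem' := ⟨fun _ => 1, contMDiff_const, rfl, fun _ => Γ.one_mem, by
    rw [mfderiv_const]; rfl⟩
  add_mem' := by
    rintro v w ⟨c, hc, hc0, hcΓ, hcv⟩ ⟨d, hd, hd0, hdΓ, hdw⟩
    refine ⟨fun t => c t * d t, hc.mul hd, by simp [hc0, hd0],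
      fun t => Γ.mul_mem (hcΓ t) (hdΓ t), ?_⟩
    have hmul : MDifferentiableAt (𝓘(ℝ, EK).prod 𝓘(ℝ, EK)) 𝓘(ℝ, EK)
        (fun q : K × K => q.1 * q.2) (c 0, d 0) :=
      (contMDiff_mul 𝓘(ℝ, EK) ∞).mdifferentiable (by simp) _
    have hc1 : MDifferentiableAt 𝓘(ℝ, ℝ) 𝓘(ℝ, EK) c 0 := hc.mdifferentiable (by simp) 0
    have hd1 : MDifferentiableAt 𝓘(ℝ, ℝ) 𝓘(ℝ, EK) d 0 := hd.mdifferentiable (by simp) 0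
    have h : HasMFDerivAt 𝓘(ℝ, ℝ) 𝓘(ℝ, EK) (fun t => c t * d t) 0 _ :=
      HasMFDerivAt.comp (0 : ℝ) (g := fun q : K × K => q.1 * q.2) hmul.hasMFDerivAt
        (hc1.hasMFDerivAt.prodMk hd1.hasMFDerivAt)
    have hid : ∀ f : K → K, f = id → ∀ (x : K) (u : EK),
        (mfderiv 𝓘(ℝ, EK) 𝓘(ℝ, EK) f x u : EK) = u := by
      rintro _ rfl x u
      rw [mfderiv_id]
      rfl
    have h2 : ∀ u u' : EK, (mfderiv (𝓘(ℝ, EK).prod 𝓘(ℝ, EK)) 𝓘(ℝ, EK)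
        (fun q : K × K => q.1 * q.2) (c 0, d 0) (u, u') : EK) = u + u' := fun u u' =>
      (mfderiv_prod_eq_add_apply (v := (u, u')) hmul).trans
        (congrArg₂ (fun a b : EK => a + b) (hid _ (by funext z; simp [hd0]) _ _)
          (hid _ (by funext z; simp [hc0]) _ _))
    refine (DFunLike.congr_fun h.mfderiv (1 : ℝ)).trans ?_
    refine (h2 _ _).trans ?_
    rw [← hcv, ← hdw]
    rfl
  smul_mem' := by
    rintro r v ⟨c, hc, hc0, hcΓ, hcv⟩
    have hr : HasMFDerivAt 𝓘(ℝ, ℝ) 𝓘(ℝ, ℝ) (fun t : ℝ => r * t) 0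
        (r • ContinuousLinearMap.id ℝ ℝ) :=
      (((hasFDerivAt_id (𝕜 := ℝ) (0 : ℝ)).const_smul r)).hasMFDerivAt
    refine ⟨fun t => c (r * t), hc.comp (contMDiff_const.mul contMDiff_id), by simp [hc0],
      fun t => hcΓ _, ?_⟩
    have hc1 : MDifferentiableAt 𝓘(ℝ, ℝ) 𝓘(ℝ, EK) c (r * 0) := hc.mdifferentiable (by simp) _
    have h := HasMFDerivAt.comp (0 : ℝ) (g := c) hc1.hasMFDerivAt hr
    refine (DFunLike.congr_fun h.mfderiv (1 : ℝ)).trans ?_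
    have e : ∀ s : ℝ, s = 0 → (mfderiv 𝓘(ℝ, ℝ) 𝓘(ℝ, EK) c s (r : ℝ) : EK) = r • v := by
      rintro s rfl
      rw [← hcv]
      have := (mfderiv 𝓘(ℝ, ℝ) 𝓘(ℝ, EK) c 0).map_smul r (1 : ℝ)
      refine Eq.trans ?_ this
      congr 1
      exact (mul_one r).symm
    refine Eq.trans ?_ (e (r * 0) (mul_zero r))
    change mfderiv 𝓘(ℝ, ℝ) 𝓘(ℝ, EK) c (r * 0) (r • (1 : ℝ)) = _
    rw [smul_eq_mul, mul_one]

end Group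

section Bundle

variable {EK : Type*} [NormedAddCommGroup EK] [NormedSpace ℝ EK]
  {K : Type*} [TopologicalSpace K] [ChartedSpace EK K] [Group K] [LieGroup 𝓘(ℝ, EK) ∞ K]
  {EM : Type*} [NormedAddCommGroup EM] [NormedSpace ℝ EM]
  {M : Type*} [TopologicalSpace M] [ChartedSpace EM M] [IsManifold 𝓘(ℝ, EM) ∞ M]
  {EP : Type*} [NormedAddCommGroup EP] [NormedSpace ℝ EP]
  {P : Type*} [TopologicalSpace P] [ChartedSpace EP P] [IsManifold 𝓘(ℝ, EP) ∞ P]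
  [MulAction Kᵐᵒᵖ P]

variable (EK EM EP K) in
/-- `pr : P → M` is a smooth principal bundle for the right action `p <• k` of the Lie group `K`:
the action is smooth, preserves the fibres, and `M` is covered by open sets `U` with a
`K`-equivariant fibre-preserving diffeomorphism `pr⁻¹(U) ≃ U × K`. -/
structure IsPrincipalBundle (pr : P → M) : Prop where
  contMDiff_proj : ContMDiff 𝓘(ℝ, EP) 𝓘(ℝ, EM) ∞ pr
  contMDiff_act : ContMDiff (𝓘(ℝ, EP).prod 𝓘(ℝ, EK)) 𝓘(ℝ, EP) ∞ fun q : P × K => q.1 <• q.2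
  proj_act : ∀ (p : P) (k : K), pr (p <• k) = pr p
  locally_trivial : ∀ x : M, ∃ (U : Set M) (ψ : OpenPartialHomeomorph P (M × K)),
    IsOpen U ∧ x ∈ U ∧ ψ.source = pr ⁻¹' U ∧ ψ.target = U ×ˢ Set.univ ∧
    ContMDiffOn 𝓘(ℝ, EP) (𝓘(ℝ, EM).prod 𝓘(ℝ, EK)) ∞ ψ ψ.source ∧
    ContMDiffOn (𝓘(ℝ, EM).prod 𝓘(ℝ, EK)) 𝓘(ℝ, EP) ∞ ψ.symm ψ.target ∧
    (∀ p ∈ ψ.source, (ψ p).1 = pr p) ∧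
    ∀ p ∈ ψ.source, ∀ k : K, (ψ (p <• k)).2 = (ψ p).2 * k

variable (EP) in
/-- The value `σ_p(a)` at `p` of the fundamental vector field of `a ∈ T₁K`: the differential at `1`
of the orbit map `k ↦ p k`, applied to `a`. -/
def fundVec (p : P) (a : GroupLieAlgebra 𝓘(ℝ, EK) K) : TangentSpace 𝓘(ℝ, EP) p :=
  mfderiv 𝓘(ℝ, EK) 𝓘(ℝ, EP) (fun k : K => p <• k) 1 a

variable (EK K EP P) in
/-- A connection form on `P`: a smooth 1-form with values in the Lie algebra `T₁K` (which is the
model space `EK` as a vector space) that reproduces the generators of the fundamental vector fields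
and is equivariant: `R_k^* ω = Ad(k⁻¹) ω`. -/
structure PrincipalConnection where
  form : OneForm EP P EK
  form_fundVec : ∀ (p : P) (a : GroupLieAlgebra 𝓘(ℝ, EK) K), form p (fundVec EP p a) = a
  form_act : ∀ (p : P) (k : K) (X : TangentSpace 𝓘(ℝ, EP) p),
    form (p <• k) (mfderiv 𝓘(ℝ, EP) 𝓘(ℝ, EP) (fun q : P => q <• k) p X) = Ad EK k⁻¹ (form p X)

/-- The projector of `TP` onto the vertical bundle: `X ↦ σ_p(ω_p(X))` for `X ∈ T_pP`. -/
def PrincipalConnection.verticalProj (A : PrincipalConnection EK K EP P)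
    (w : TangentBundle 𝓘(ℝ, EP) P) : TangentBundle 𝓘(ℝ, EP) P :=
  ⟨w.proj, fundVec (K := K) EP w.proj (A.form w.proj w.2)⟩

/-- The quotient `P/Γ` of `P` by the right action of the subgroup `Γ` of `K`, with the quotient
topology. -/
abbrev QuotBy (P : Type*) {K : Type*} [Group K] [MulAction Kᵐᵒᵖ P] (Γ : Subgroup K) : Type _ :=
  Quotient (MulAction.orbitRel Γ.op P)

/-- The projection `P → P/Γ`. -/
def quotMk (Γ : Subgroup K) (p : P) : QuotBy P Γ := Quotient.mk _ p

/-- The projection `P/Γ → M` induced by `pr : P → M`. -/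
def IsPrincipalBundle.quotProj {pr : P → M} (hP : IsPrincipalBundle EK K EM EP pr) (Γ : Subgroup K) :
    QuotBy P Γ → M :=
  Quotient.lift pr <| by
    rintro p q ⟨γ, rfl⟩
    exact hP.proj_act q (MulOpposite.unop γ.1)

/-- The fibre of `P/Γ → M` over `x`. -/
abbrev IsPrincipalBundle.Fiber {pr : P → M} (hP : IsPrincipalBundle EK K EM EP pr) (Γ : Subgroup K)
    (x : M) : Type _ := {y : QuotBy P Γ // hP.quotProj Γ y = x}

variable {EE : Type*} [NormedAddCommGroup EE] [NormedSpace ℝ EE]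
  (Γ : Subgroup K) [ChartedSpace EE (QuotBy P Γ)]
  {EF : Type*} [NormedAddCommGroup EF] [NormedSpace ℝ EF]
  [ChartedSpace EF (K ⧸ Γ)] [IsManifold 𝓘(ℝ, EF) ∞ (K ⧸ Γ)]

variable (EE EP) in
/-- The differential `TP → T(P/Γ)` of the projection `P → P/Γ`. -/
def tangentQuotMk (w : TangentBundle 𝓘(ℝ, EP) P) : TangentBundle 𝓘(ℝ, EE) (QuotBy P Γ) :=
  tangentMap 𝓘(ℝ, EP) 𝓘(ℝ, EE) (quotMk Γ) w

open Classical in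
variable (EE) in
/-- The operator field `ω_E` on `E = P/Γ` induced by a connection on `P`: `ω_E(v)` is obtained by
lifting `v` to a tangent vector `w` of `P`, projecting `w` to its vertical part, and mapping the
result back to `TE`. -/
def PrincipalConnection.induced (A : PrincipalConnection EK K EP P)
    (v : TangentBundle 𝓘(ℝ, EE) (QuotBy P Γ)) : TangentBundle 𝓘(ℝ, EE) (QuotBy P Γ) :=
  if h : ∃ w, tangentQuotMk EP EE Γ w = v then tangentQuotMk EP EE Γ (A.verticalProj h.choose)
  else v

variable (EE) in
/-- The horizontal distribution of the induced connection on `P/Γ`: the image in `T(P/Γ)` of the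
horizontal distribution `ker ω` of `P`. -/
def PrincipalConnection.horizontal (A : PrincipalConnection EK K EP P) :
    Set (TangentBundle 𝓘(ℝ, EE) (QuotBy P Γ)) :=
  {v | ∃ w : TangentBundle 𝓘(ℝ, EP) P, A.form w.proj w.2 = (0 : EK) ∧ tangentQuotMk EP EE Γ w = v}

variable {Γ}

/-- The 1-form `ξ` on `K/Γ` is invariant under the left translations by all elements of `K`. -/
def IsInvariant (ξ : OneForm EF (K ⧸ Γ) ℝ) : Prop :=
  ∀ (k : K) (y : K ⧸ Γ) (v : TangentSpace 𝓘(ℝ, EF) y),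
    ξ (k • y) (mfderiv 𝓘(ℝ, EF) 𝓘(ℝ, EF) (fun z : K ⧸ Γ => k • z) y v) = ξ y v

/-- The value of `ξ` at the base point, as a functional `ξ₀` on `T₁K` through the differential of
the projection `K → K/Γ` at `1`. -/
def valueAtBase (ξ : OneForm EF (K ⧸ Γ) ℝ) (a : GroupLieAlgebra 𝓘(ℝ, EK) K) : ℝ :=
  ξ ((1 : K) : K ⧸ Γ) (mfderiv 𝓘(ℝ, EK) 𝓘(ℝ, EF) (fun k : K => (k : K ⧸ Γ)) 1 a)

open Classical in
variable (EP) in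
/-- The fibrewise linear function on the vertical bundle of `P/Γ` defined by `ξ`: the vertical
vector `[p, a]`, which is the image in `T(P/Γ)` of `σ_p(a)` with `a ∈ 𝔪`, goes to `ξ₀(a)`. (Vectors
that are not vertical get the value `0`.) -/
def alphaTilde (ξ : OneForm EF (K ⧸ Γ) ℝ) (𝔪 : Submodule ℝ (GroupLieAlgebra 𝓘(ℝ, EK) K))
    (v : TangentBundle 𝓘(ℝ, EE) (QuotBy P Γ)) : ℝ :=
  if h : ∃ b : P × GroupLieAlgebra 𝓘(ℝ, EK) K,
      b.2 ∈ 𝔪 ∧ tangentQuotMk EP EE Γ ⟨b.1, fundVec EP b.1 b.2⟩ = v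
  then valueAtBase ξ h.choose.2 else 0

end Bundle

end

end HGB

/-! The form is found upstairs. On `P` consider `ξ₀ ∘ ω`, where `ω` is the connection form. It is
basic for `P → P/Γ`. It is `Γ`-invariant, because `ω` is `Ad`-equivariant and the value `ξ₀` of an
invariant form is `Ad(Γ)`-invariant. It also kills the kernel of `TP → T(P/Γ)`: a kernel vector is
vertical for `P → M`, hence of the form `σ_p(c)`, and comparing `k ↦ [p k]` with `k ↦ [k]` shows
that `c` dies in `T(K/Γ)`, so `ξ₀(c) = 0` (`PrincipalConnection.eq_of_quotDiff_eq`). Smooth local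
sections of the submersion `P → P/Γ` make the descended form `α` smooth (`exists_descended_form`).

To identify `α` with the composition of the two maps, split `ω(u) = c + b` with `c` in the Lie
algebra of `Γ` and `b ∈ 𝔪`. The part `c` contributes nothing on either side, and both give `ξ₀(b)`
(`alphaTilde_induced`). Vanishing on horizontal vectors is then immediate.

On the fibre over `pr p`, every tangent vector at `[p k]` is the image of some `σ_{pk}(c)`, where
`α` takes the value `ξ₀(c)`. Under `[p k] ↦ [k]` it becomes the velocity of `l ↦ [k l]` in direction
`c`, where `ξ` is also `ξ₀(c)` by invariance. Hence the restriction of `α` is the pullback of `ξ`,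
which gives closedness and the cohomology class. -/

namespace HGB
noncomputable section

set_option linter.unusedSectionVars false

/-! ### Submersions: local sections and descent of smoothness. -/

section Submersion
variable {E : Type*} [NormedAddCommGroup E] [NormedSpace ℝ E]
  {M : Type*} [TopologicalSpace M] [ChartedSpace E M]
  {E' : Type*} [NormedAddCommGroup E'] [NormedSpace ℝ E']
  {N : Type*} [TopologicalSpace N] [ChartedSpace E' N]
  {E'' : Type*} [NormedAddCommGroup E''] [NormedSpace ℝ E'']
  {Q : Type*} [TopologicalSpace Q] [ChartedSpace E'' Q]

/-- A submersion has a smooth local section through every point of its domain. -/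
theorem exists_localSection {f : M → N} (hf : Manifold.IsSubmersion 𝓘(ℝ, E) 𝓘(ℝ, E') ∞ f)
    (x : M) : ∃ s : N → M, s (f x) = x ∧ ContMDiffAt 𝓘(ℝ, E') 𝓘(ℝ, E) ∞ s (f x) ∧
      ∀ᶠ y in nhds (f x), f (s y) = y := by
  have h := hf.isSubmersionAt x
  set φ := h.domChart with hφ
  set ψ := h.codChart with hψ
  have hx : x ∈ φ.source := h.mem_domChart_source
  have hfx : f x ∈ ψ.source := h.mem_codChart_source
  have hw : ∀ z ∈ φ.target, ψ (f (φ.symm z)) = (h.equiv z).1 := fun z hz => by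
    simpa using h.writtenInCharts (show z ∈ (φ.extend 𝓘(ℝ, E)).target by simpa using hz)
  have hm : ∀ z ∈ φ.target, f (φ.symm z) ∈ ψ.source := fun z hz =>
    h.source_subset_preimage_source (φ.map_target hz)
  -- In the charts `f` is the projection to the first factor; the section keeps the second
  -- coordinate frozen at that of `x`.
  let g : N → E := fun y => h.equiv.symm (ψ y, (h.equiv (φ x)).2)
  have hgx : g (f x) = φ x := by
    have := hw (φ x) (φ.map_source hx)
    rw [φ.left_inv hx] at this
    simp [g, this]
  have hg : ContMDiffAt 𝓘(ℝ, E') 𝓘(ℝ, E) ∞ g (f x) := by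
    have h1 : ContMDiffAt 𝓘(ℝ, E') 𝓘(ℝ, E') ∞ ψ (f x) :=
      contMDiffAt_of_mem_maximalAtlas h.codChart_mem_maximalAtlas hfx
    have h2 : ContDiff ℝ ∞ fun u : E' => h.equiv.symm (u, (h.equiv (φ x)).2) := by fun_prop
    exact h2.contMDiff.contMDiffAt.comp (f x) h1
  have hgt : ∀ᶠ y in nhds (f x), g y ∈ φ.target := by
    refine hg.continuousAt.eventually_mem (φ.open_target.mem_nhds ?_)
    rw [hgx]
    exact φ.map_source hx
  refine ⟨fun y => φ.symm (g y), ?_, ?_, ?_⟩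
  · simp [hgx, φ.left_inv hx]
  · refine ContMDiffAt.comp (f x) (g := φ.symm) ?_ hg
    rw [hgx]
    exact contMDiffAt_symm_of_mem_maximalAtlas h.domChart_mem_maximalAtlas (φ.map_source hx)
  · filter_upwards [hgt, ψ.open_source.mem_nhds hfx] with y hy hy'
    have := hw (g y) hy
    simp only [g, ContinuousLinearEquiv.apply_symm_apply] at this
    exact ψ.injOn (hm _ hy) hy' this

/-- A map out of the base of a submersion is smooth where its composition with the submersion
is. -/
theorem contMDiffAt_of_comp_submersion {f : M → N}
    (hf : Manifold.IsSubmersion 𝓘(ℝ, E) 𝓘(ℝ, E') ∞ f) {g : N → Q} {x : M}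
    (h : ContMDiffAt 𝓘(ℝ, E) 𝓘(ℝ, E'') ∞ (fun y => g (f y)) x) :
    ContMDiffAt 𝓘(ℝ, E') 𝓘(ℝ, E'') ∞ g (f x) := by
  obtain ⟨s, hsx, hs, hfs⟩ := exists_localSection hf x
  refine (ContMDiffAt.comp_of_eq (g := fun y => g (f y)) h hs hsx).congr_of_eventuallyEq ?_
  filter_upwards [hfs] with y hy
  simp [hy]

theorem mfderiv_comp_localSection {f : M → N} {s : N → M} {y : N}
    (hf : MDifferentiableAt 𝓘(ℝ, E) 𝓘(ℝ, E') f (s y))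
    (hs : MDifferentiableAt 𝓘(ℝ, E') 𝓘(ℝ, E) s y) (h : ∀ᶠ z in nhds y, f (s z) = z) (v : E') :
    (mfderiv 𝓘(ℝ, E) 𝓘(ℝ, E') f (s y) (mfderiv 𝓘(ℝ, E') 𝓘(ℝ, E) s y v) : E') = v := by
  have h1 := mfderiv_comp y hf hs
  have h2 : mfderiv 𝓘(ℝ, E') 𝓘(ℝ, E') (f ∘ s) y = mfderiv 𝓘(ℝ, E') 𝓘(ℝ, E') id y :=
    Filter.EventuallyEq.mfderiv_eq h
  rw [h2, mfderiv_id] at h1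
  exact (DFunLike.congr_fun h1 v).symm

/-- The differential of a submersion is surjective. -/
theorem mfderiv_surjective_of_submersion {f : M → N}
    (hf : Manifold.IsSubmersion 𝓘(ℝ, E) 𝓘(ℝ, E') ∞ f)
    (hfd : ContMDiff 𝓘(ℝ, E) 𝓘(ℝ, E') ∞ f) (x : M) (v : E') :
    ∃ u : E, (mfderiv 𝓘(ℝ, E) 𝓘(ℝ, E') f x u : E') = v := by
  obtain ⟨s, hsx, hs, hfs⟩ := exists_localSection hf x
  have := mfderiv_comp_localSection (hfd.mdifferentiable (by simp) _)
    (hs.mdifferentiableAt (by simp)) hfs v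
  rw [hsx] at this
  exact ⟨_, this⟩

end Submersion

/-! ### Smoothness of covector fields that are pullbacks near a point. -/

section Forms
variable {E : Type*} [NormedAddCommGroup E] [NormedSpace ℝ E]
  {M : Type*} [TopologicalSpace M] [ChartedSpace E M] [IsManifold 𝓘(ℝ, E) ∞ M]
  {E' : Type*} [NormedAddCommGroup E'] [NormedSpace ℝ E']
  {N : Type*} [TopologicalSpace N] [ChartedSpace E' N] [IsManifold 𝓘(ℝ, E') ∞ N]
  {V : Type*} [NormedAddCommGroup V] [NormedSpace ℝ V]
  {W : Type*} [NormedAddCommGroup W] [NormedSpace ℝ W]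

/-- A field of covectors that is near `x` of the form `L ∘ f^*β`, with `f` smooth at `x`, is smooth
at `x`. -/
theorem contMDiffAt_comp_pullback {f : M → N} {x : M}
    (hf : ContMDiffAt 𝓘(ℝ, E) 𝓘(ℝ, E') ∞ f x) (β : OneForm E' N V) (L : V →L[ℝ] W)
    {α : ∀ x : M, TangentSpace 𝓘(ℝ, E) x →L[ℝ] Trivial M W x}
    (hα : ∀ᶠ y in nhds x, ∀ v : E, (α y v : W) = L (β (f y) (mfderiv 𝓘(ℝ, E) 𝓘(ℝ, E') f y v))) :
    ContMDiffAt 𝓘(ℝ, E) (𝓘(ℝ, E).prod 𝓘(ℝ, E →L[ℝ] W)) ∞ (fun x =>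
      TotalSpace.mk' (E →L[ℝ] W)
        (E := fun x : M => TangentSpace 𝓘(ℝ, E) x →L[ℝ] Trivial M W x) x (α x)) x := by
  rw [contMDiffAt_hom_bundle]
  refine ⟨contMDiffAt_id, ?_⟩
  have h1 := (((contMDiffAt_hom_bundle _).1 (β.contMDiff (f x))).2).comp x hf
  have h2 := hf.mfderiv_const (m := ∞) (by simp)
  refine (ContMDiffAt.clm_comp (contMDiffAt_const (c := L))
    (ContMDiffAt.clm_comp h1 h2)).congr_of_eventuallyEq ?_
  have hN : ∀ᶠ y in nhds x, f y ∈ (trivializationAt E' (TangentSpace 𝓘(ℝ, E')) (f x)).baseSet :=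
    hf.continuousAt.eventually
      ((trivializationAt E' (TangentSpace 𝓘(ℝ, E')) (f x)).open_baseSet.mem_nhds
        (FiberBundle.mem_baseSet_trivializationAt' (f x)))
  filter_upwards [hN, hα] with y hy hy'
  ext v
  simp only [ContinuousLinearMap.inCoordinates, inTangentCoordinates, Function.comp_apply, id_eq,
    ContinuousLinearMap.comp_apply, Trivialization.continuousLinearMapAt_apply]
  -- The trivialization of `TN` at `f x` enters once through `β` and once, inverted, through the
  -- differential of `f`; over its base set the two cancel.
  rw [← Trivialization.continuousLinearMapAt_apply (R := ℝ) (trivializationAt E' _ (f x)),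
    Trivialization.symmL_continuousLinearMapAt _ hy]
  have := hy' (Trivialization.symmL ℝ (trivializationAt E (TangentSpace 𝓘(ℝ, E)) x) y v)
  simpa using this

end Forms

/-! ### The chain rule with values in model spaces. -/

section ChainRule
variable {E : Type*} [NormedAddCommGroup E] [NormedSpace ℝ E]
  {M : Type*} [TopologicalSpace M] [ChartedSpace E M]
  {E' : Type*} [NormedAddCommGroup E'] [NormedSpace ℝ E']
  {N : Type*} [TopologicalSpace N] [ChartedSpace E' N]
  {E'' : Type*} [NormedAddCommGroup E''] [NormedSpace ℝ E'']
  {Q : Type*} [TopologicalSpace Q] [ChartedSpace E'' Q]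

/-- Keeping `f x = y` as a hypothesis, with all vectors in the model spaces, allows base points that
agree only propositionally, such as `p <• 1` and `p`. -/
theorem mfderiv_chain {f : M → N} {g : N → Q} {h : M → Q} {x : M} {y : N} (hy : f x = y)
    (hg : ContMDiffAt 𝓘(ℝ, E') 𝓘(ℝ, E'') ∞ g y) (hf : ContMDiffAt 𝓘(ℝ, E) 𝓘(ℝ, E') ∞ f x)
    (hh : ∀ z, h z = g (f z)) (v : E) :
    (mfderiv 𝓘(ℝ, E) 𝓘(ℝ, E'') h x v : E'') =
      mfderiv 𝓘(ℝ, E') 𝓘(ℝ, E'') g y (mfderiv 𝓘(ℝ, E) 𝓘(ℝ, E') f x v : E') := by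
  obtain rfl : h = g ∘ f := funext hh
  subst hy
  rw [mfderiv_comp x (hg.mdifferentiableAt (by simp)) (hf.mdifferentiableAt (by simp))]
  rfl

theorem mfderiv_apply_eq_self {f : M → M} (hf : ∀ z, f z = z) (x : M) (v : E) :
    (mfderiv 𝓘(ℝ, E) 𝓘(ℝ, E) f x v : E) = v := by
  obtain rfl : f = id := funext hf
  rw [mfderiv_id]
  rfl

theorem mfderiv_apply_eq_zero {f : M → N} {c : N} (hf : ∀ z, f z = c) (x : M) (v : E) :
    (mfderiv 𝓘(ℝ, E) 𝓘(ℝ, E') f x v : E') = 0 := by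
  obtain rfl : f = fun _ => c := funext hf
  rw [mfderiv_const]
  rfl

end ChainRule

/-! ### Right actions and principal bundles: orbits and fibres. -/

section Action
variable {K : Type*} [Group K] {P : Type*} [MulAction Kᵐᵒᵖ P]

theorem act_act (p : P) (k l : K) : (p <• k) <• l = p <• (k * l) := by
  rw [smul_smul, ← MulOpposite.op_mul]

theorem act_one (p : P) : p <• (1 : K) = p := by
  rw [MulOpposite.op_one, one_smul]

theorem quotMk_act (Γ : Subgroup K) (p : P) {γ : K} (hγ : γ ∈ Γ) :
    quotMk Γ (p <• γ) = quotMk Γ p :=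
  Quotient.sound ⟨⟨MulOpposite.op γ, hγ⟩, rfl⟩

theorem exists_of_quotMk_eq {Γ : Subgroup K} {p q : P} (h : quotMk Γ p = quotMk Γ q) :
    ∃ γ ∈ Γ, q = p <• γ := by
  obtain ⟨γ, hγ⟩ := Quotient.exact h.symm
  exact ⟨MulOpposite.unop γ.1, γ.2, hγ.symm⟩

end Action

section Bundle

variable {EK : Type*} [NormedAddCommGroup EK] [NormedSpace ℝ EK]
  {K : Type*} [TopologicalSpace K] [ChartedSpace EK K] [Group K]
  {EM : Type*} [NormedAddCommGroup EM] [NormedSpace ℝ EM]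
  {M : Type*} [TopologicalSpace M] [ChartedSpace EM M]
  {EP : Type*} [NormedAddCommGroup EP] [NormedSpace ℝ EP]
  {P : Type*} [TopologicalSpace P] [ChartedSpace EP P]
  [MulAction Kᵐᵒᵖ P]
  {EE : Type*} [NormedAddCommGroup EE] [NormedSpace ℝ EE]
  {Γ : Subgroup K} [ChartedSpace EE (QuotBy P Γ)]
  {EF : Type*} [NormedAddCommGroup EF] [NormedSpace ℝ EF] [ChartedSpace EF (K ⧸ Γ)]

variable (EK EP K) in
/-- The linear map `a ↦ σ_p(a)`. -/
def fundMap (p : P) : EK →L[ℝ] EP :=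
  mfderiv 𝓘(ℝ, EK) 𝓘(ℝ, EP) (fun k : K => p <• k) 1

variable (EP) in
/-- The differential at `p` of the right translation by `k`. -/
def actDiff (k : K) (p : P) : EP →L[ℝ] EP :=
  mfderiv 𝓘(ℝ, EP) 𝓘(ℝ, EP) (fun q : P => q <• k) p

variable (EP EE Γ) in
/-- The differential at `p` of the projection `P → P/Γ`. -/
def quotDiff (p : P) : EP →L[ℝ] EE :=
  mfderiv 𝓘(ℝ, EP) 𝓘(ℝ, EE) (quotMk Γ : P → QuotBy P Γ) p

variable (EK EF Γ) in
/-- The differential at `1` of the projection `K → K/Γ`. -/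
def cosetDiff : EK →L[ℝ] EF :=
  mfderiv 𝓘(ℝ, EK) 𝓘(ℝ, EF) (fun k : K => (k : K ⧸ Γ)) 1

variable (EK) in
/-- The adjoint action as a continuous linear map. -/
def adMap (g : K) : EK →L[ℝ] EK :=
  mfderiv 𝓘(ℝ, EK) 𝓘(ℝ, EK) (fun k : K => g * k * g⁻¹) 1

variable {pr : P → M} (hP : IsPrincipalBundle EK K EM EP pr)
include hP

theorem IsPrincipalBundle.contMDiff_orbit (p : P) :
    ContMDiff 𝓘(ℝ, EK) 𝓘(ℝ, EP) ∞ fun k : K => p <• k :=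
  hP.contMDiff_act.comp (contMDiff_const.prodMk contMDiff_id)

theorem IsPrincipalBundle.contMDiff_translate (k : K) :
    ContMDiff 𝓘(ℝ, EP) 𝓘(ℝ, EP) ∞ fun p : P => p <• k :=
  hP.contMDiff_act.comp (contMDiff_id.prodMk contMDiff_const)

theorem IsPrincipalBundle.exists_act_eq {p q : P} (h : pr q = pr p) : ∃ k : K, q = p <• k := by
  obtain ⟨U, ψ, -, hx, hs, -, -, -, h1, h2⟩ := hP.locally_trivial (pr p)
  have hp : p ∈ ψ.source := by rw [hs]; exact hx
  have hq : q ∈ ψ.source := by rw [hs, Set.mem_preimage, h]; exact hx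
  refine ⟨(ψ p).2⁻¹ * (ψ q).2, ψ.injOn hq ?_ (Prod.ext ?_ ?_)⟩
  · rw [hs, Set.mem_preimage, hP.proj_act]; exact hx
  · rw [h1 q hq, h1 _ (by rw [hs, Set.mem_preimage, hP.proj_act]; exact hx), hP.proj_act, h]
  · rw [h2 p hp, mul_inv_cancel_left]

theorem IsPrincipalBundle.exists_proj_eq (x : M) : ∃ p : P, pr p = x := by
  obtain ⟨U, ψ, -, hx, hs, ht, -, -, h1, -⟩ := hP.locally_trivial x
  have h : ((x, 1) : M × K) ∈ ψ.target := by rw [ht]; exact ⟨hx, trivial⟩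
  refine ⟨ψ.symm (x, 1), ?_⟩
  rw [← h1 _ (ψ.map_target h), ψ.right_inv h]

end Bundle

/-! ### Vertical vectors of `P → M`, and local retractions of `P/Γ` to `K/Γ`. -/

section LieGroupBundle

variable {EK : Type*} [NormedAddCommGroup EK] [NormedSpace ℝ EK]
  {K : Type*} [TopologicalSpace K] [ChartedSpace EK K] [Group K] [LieGroup 𝓘(ℝ, EK) ∞ K]
  {EM : Type*} [NormedAddCommGroup EM] [NormedSpace ℝ EM]
  {M : Type*} [TopologicalSpace M] [ChartedSpace EM M]
  {EP : Type*} [NormedAddCommGroup EP] [NormedSpace ℝ EP]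
  {P : Type*} [TopologicalSpace P] [ChartedSpace EP P]
  [MulAction Kᵐᵒᵖ P]
  {EE : Type*} [NormedAddCommGroup EE] [NormedSpace ℝ EE]
  {Γ : Subgroup K} [ChartedSpace EE (QuotBy P Γ)]
  {EF : Type*} [NormedAddCommGroup EF] [NormedSpace ℝ EF] [ChartedSpace EF (K ⧸ Γ)]
theorem contMDiff_leftMul (g : K) : ContMDiff 𝓘(ℝ, EK) 𝓘(ℝ, EK) ∞ fun k : K => g * k :=
  contMDiff_mul_left

theorem contMDiff_conj (g : K) : ContMDiff 𝓘(ℝ, EK) 𝓘(ℝ, EK) ∞ fun k : K => g * k * g⁻¹ :=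
  (contMDiff_mul_left (I := 𝓘(ℝ, EK)) (a := g)).mul contMDiff_const

/-- Left translations of `K/Γ` are smooth. -/
theorem contMDiff_leftSMul
    (hKΓ : Manifold.IsSubmersion 𝓘(ℝ, EK) 𝓘(ℝ, EF) ∞ (fun k : K => (k : K ⧸ Γ))) (g : K) :
    ContMDiff 𝓘(ℝ, EF) 𝓘(ℝ, EF) ∞ fun z : K ⧸ Γ => g • z := by
  intro z
  obtain ⟨k, rfl⟩ := QuotientGroup.mk_surjective z
  exact contMDiffAt_of_comp_submersion hKΓ (g := fun z : K ⧸ Γ => g • z) (x := k)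
    (hKΓ.contMDiff.comp (contMDiff_leftMul g)).contMDiffAt

variable {pr : P → M} (hP : IsPrincipalBundle EK K EM EP pr)
include hP

/-- A vector of `TP` that is tangent to the fibre of `P → M` is a value of a fundamental vector
field. -/
theorem IsPrincipalBundle.exists_fundMap_eq (p : P) (u : EP)
    (hu : (mfderiv 𝓘(ℝ, EP) 𝓘(ℝ, EM) pr p u : EM) = 0) : ∃ c : EK, fundMap EK K EP p c = u := by
  obtain ⟨U, ψ, -, hx, hs, ht, hψ, hψs, h1, h2⟩ := hP.locally_trivial (pr p)
  have hp : p ∈ ψ.source := by rw [hs]; exact hx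
  set g := (ψ p).2 with hg
  have hψp : ContMDiffAt 𝓘(ℝ, EP) (𝓘(ℝ, EM).prod 𝓘(ℝ, EK)) ∞ ψ p :=
    hψ.contMDiffAt (ψ.open_source.mem_nhds hp)
  have hg2 : ContMDiffAt 𝓘(ℝ, EP) 𝓘(ℝ, EK) ∞ (fun q => (ψ q).2) p :=
    contMDiffAt_snd.comp p hψp
  have htx : ∀ k, ((pr p, k) : M × K) ∈ ψ.target := fun k => by rw [ht]; exact ⟨hx, trivial⟩
  -- In the trivialization the slice `{pr p} × K` is the orbit of `p`, shifted by `g⁻¹` because `p`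
  -- itself has group coordinate `g`.
  have hsym : ∀ k : K, ψ.symm (pr p, k) = p <• (g⁻¹ * k) := fun k => by
    have hpk : p <• (g⁻¹ * k) ∈ ψ.source := by rw [hs, Set.mem_preimage, hP.proj_act]; exact hx
    rw [← ψ.left_inv hpk]
    congr 1
    exact Prod.ext ((h1 _ hpk).trans (hP.proj_act _ _)).symm (by rw [h2 p hp]; simp [hg])
  have hsm : MDifferentiableAt (𝓘(ℝ, EM).prod 𝓘(ℝ, EK)) 𝓘(ℝ, EP) ψ.symm (pr p, g) :=
    (hψs.contMDiffAt (ψ.open_target.mem_nhds (htx g))).mdifferentiableAt (by simp)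
  have hprm : MDifferentiableAt 𝓘(ℝ, EP) 𝓘(ℝ, EM) pr p :=
    hP.contMDiff_proj.mdifferentiable (by simp) p
  have hgm : MDifferentiableAt 𝓘(ℝ, EP) 𝓘(ℝ, EK) (fun q => (ψ q).2) p :=
    hg2.mdifferentiableAt (by simp)
  have hcomp := HasMFDerivAt.comp p (g := ψ.symm) (f := fun q => (pr q, (ψ q).2)) hsm.hasMFDerivAt
    (hprm.hasMFDerivAt.prodMk hgm.hasMFDerivAt)
  have hid : ψ.symm ∘ (fun q => (pr q, (ψ q).2)) =ᶠ[nhds p] id := by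
    filter_upwards [ψ.open_source.mem_nhds hp] with q hq
    have : (pr q, (ψ q).2) = ψ q := Prod.ext (h1 q hq).symm rfl
    simp only [Function.comp_apply, id_eq]
    rw [this, ψ.left_inv hq]
  have hd := hcomp.mfderiv
  rw [hid.mfderiv_eq, mfderiv_id] at hd
  set w : EK := (mfderiv 𝓘(ℝ, EP) 𝓘(ℝ, EK) (fun q => (ψ q).2) p u : EK) with hw
  -- Differentiating `ψ.symm ∘ ψ = id` recovers `u` from its two components, and verticality kills
  -- the one along `M`.
  have e1 : u = (mfderiv (𝓘(ℝ, EM).prod 𝓘(ℝ, EK)) 𝓘(ℝ, EP) ψ.symm (pr p, g)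
      ((0 : EM), w) : EP) := by
    have := DFunLike.congr_fun hd u
    refine this.trans ?_
    change (mfderiv (𝓘(ℝ, EM).prod 𝓘(ℝ, EK)) 𝓘(ℝ, EP) ψ.symm (pr p, g)
      ((mfderiv 𝓘(ℝ, EP) 𝓘(ℝ, EM) pr p u : EM), w) : EP) = _
    rw [hu]
    rfl
  refine ⟨(mfderiv 𝓘(ℝ, EK) 𝓘(ℝ, EK) (fun k => g⁻¹ * k) g w : EK), ?_⟩
  have e2 := mfderiv_chain (h := fun k => ψ.symm (pr p, k)) (f := fun k => g⁻¹ * k)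
    (g := fun k => p <• k) (x := g) (y := (1 : K)) (by simp)
    (hP.contMDiff_orbit p).contMDiffAt (contMDiff_leftMul g⁻¹).contMDiffAt hsym w
  refine e2.symm.trans ?_
  rw [e1]
  have e3 := HasMFDerivAt.comp g (g := ψ.symm) (f := fun k : K => (pr p, k)) hsm.hasMFDerivAt
    ((hasMFDerivAt_const (I := 𝓘(ℝ, EK)) (I' := 𝓘(ℝ, EM)) (pr p) g).prodMk (hasMFDerivAt_id g))
  exact DFunLike.congr_fun e3.mfderiv w

/-- Every point `p` of `P` gives a smooth map from the part of `P/Γ` over a neighbourhood of `pr p`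
to `K/Γ` that sends the class of `p k` to `[k]`. -/
theorem IsPrincipalBundle.exists_retraction
    (hPΓ : Manifold.IsSubmersion 𝓘(ℝ, EP) 𝓘(ℝ, EE) ∞ (quotMk Γ : P → QuotBy P Γ))
    (hq : ContMDiff 𝓘(ℝ, EK) 𝓘(ℝ, EF) ∞ (fun k : K => (k : K ⧸ Γ))) (p : P) :
    ∃ θ : QuotBy P Γ → K ⧸ Γ, (∀ k : K, θ (quotMk Γ (p <• k)) = k) ∧
      ∀ k : K, ContMDiffAt 𝓘(ℝ, EE) 𝓘(ℝ, EF) ∞ θ (quotMk Γ (p <• k)) := by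
  classical
  obtain ⟨U, ψ, -, hx, hs, -, hψ, -, -, h2⟩ := hP.locally_trivial (pr p)
  have hp : p ∈ ψ.source := by rw [hs]; exact hx
  -- The factor `(ψ p).2⁻¹` normalises `p` to the base coset. The constant value off `ψ.source` is
  -- harmless: that set is `K`-invariant, so `f` still descends to `P/Γ`, and smoothness is claimed
  -- only at classes of points `p <• k`.
  let f : P → K ⧸ Γ := fun q => if q ∈ ψ.source then (((ψ p).2⁻¹ * (ψ q).2 : K) : K ⧸ Γ) else
    ((1 : K) : K ⧸ Γ)
  have hsk : ∀ (q : P) (k : K), q <• k ∈ ψ.source ↔ q ∈ ψ.source := fun q k => by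
    rw [hs, Set.mem_preimage, Set.mem_preimage, hP.proj_act]
  let θ : QuotBy P Γ → K ⧸ Γ := Quotient.lift f <| by
    rintro _ q ⟨⟨γ, hγ⟩, rfl⟩
    obtain ⟨γ, rfl⟩ := MulOpposite.op_surjective γ
    change f (q <• γ) = f q
    by_cases hq' : q ∈ ψ.source
    · simp only [f, if_pos hq', if_pos ((hsk q γ).2 hq'), h2 q hq' γ]
      rw [← mul_assoc]
      exact QuotientGroup.mk_mul_of_mem _ hγ
    · simp only [f, if_neg hq', if_neg (mt (hsk q γ).1 hq')]
  refine ⟨θ, fun k => ?_, fun k => ?_⟩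
  · change f (p <• k) = k
    simp only [f, if_pos ((hsk p k).2 hp), h2 p hp k, inv_mul_cancel_left]
  · refine contMDiffAt_of_comp_submersion hPΓ (g := θ) ?_
    have hpk := (hsk p k).2 hp
    have h3 : ContMDiffAt 𝓘(ℝ, EP) 𝓘(ℝ, EK) ∞ (fun q => (ψ q).2) (p <• k) :=
      contMDiffAt_snd.comp _ (hψ.contMDiffAt (ψ.open_source.mem_nhds hpk))
    have h4 : ContMDiffAt 𝓘(ℝ, EP) 𝓘(ℝ, EF) ∞
        (fun q => (((ψ p).2⁻¹ * (ψ q).2 : K) : K ⧸ Γ)) (p <• k) :=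
      hq.contMDiffAt.comp (p <• k) ((contMDiff_leftMul (ψ p).2⁻¹).contMDiffAt.comp (p <• k) h3)
    refine h4.congr_of_eventuallyEq ?_
    filter_upwards [ψ.open_source.mem_nhds hpk] with q hq'
    exact if_pos hq'

end LieGroupBundle

/-! ### Kernels and equivariance of the differentials; `ξ₀ ∘ ω` is basic. -/

section Differentials

variable {EK : Type*} [NormedAddCommGroup EK] [NormedSpace ℝ EK]
  {K : Type*} [TopologicalSpace K] [ChartedSpace EK K] [Group K] [LieGroup 𝓘(ℝ, EK) ∞ K]
  {EM : Type*} [NormedAddCommGroup EM] [NormedSpace ℝ EM]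
  {M : Type*} [TopologicalSpace M] [ChartedSpace EM M]
  {EP : Type*} [NormedAddCommGroup EP] [NormedSpace ℝ EP]
  {P : Type*} [TopologicalSpace P] [ChartedSpace EP P]
  [MulAction Kᵐᵒᵖ P]
  {EE : Type*} [NormedAddCommGroup EE] [NormedSpace ℝ EE]
  {Γ : Subgroup K} [ChartedSpace EE (QuotBy P Γ)]
  {EF : Type*} [NormedAddCommGroup EF] [NormedSpace ℝ EF]
  [ChartedSpace EF (K ⧸ Γ)]
  {pr : P → M}
  (hKΓ : Manifold.IsSubmersion 𝓘(ℝ, EK) 𝓘(ℝ, EF) ∞ (fun k : K => (k : K ⧸ Γ)))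
  (hP : IsPrincipalBundle EK K EM EP pr)
  (hPΓ : Manifold.IsSubmersion 𝓘(ℝ, EP) 𝓘(ℝ, EE) ∞ (quotMk Γ : P → QuotBy P Γ))

include hP

include hKΓ hPΓ in
/-- The orbit map `K/Γ → P/Γ`, `[k] ↦ [p k]`, is smooth. -/
theorem exists_orbitMap (p : P) : ∃ j : K ⧸ Γ → QuotBy P Γ,
    ContMDiff 𝓘(ℝ, EF) 𝓘(ℝ, EE) ∞ j ∧ ∀ k : K, j k = quotMk Γ (p <• k) := by
  let j : K ⧸ Γ → QuotBy P Γ := Quotient.lift (fun k : K => quotMk Γ (p <• k)) <| by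
    intro k l h
    have h' : k⁻¹ * l ∈ Γ := QuotientGroup.leftRel_apply.1 h
    have := quotMk_act Γ (p <• k) h'
    rw [act_act, mul_inv_cancel_left] at this
    exact this.symm
  refine ⟨j, fun z => ?_, fun k => rfl⟩
  obtain ⟨k, rfl⟩ := QuotientGroup.mk_surjective z
  exact contMDiffAt_of_comp_submersion hKΓ (g := j) (x := k)
    (hPΓ.contMDiff.comp (hP.contMDiff_orbit p)).contMDiffAt

include hKΓ hPΓ in
-- The maps `k ↦ [p k]` and `k ↦ [k]` factor through each other, by the orbit map in one direction
-- and by the retraction of `exists_retraction` in the other. Their differentials at `1` therefore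
-- have the same kernel.
theorem quotDiff_fundMap_eq_zero_iff (p : P) (c : EK) :
    quotDiff EP EE Γ p (fundMap EK K EP p c) = 0 ↔ cosetDiff EK Γ EF c = 0 := by
  have hπ : (mfderiv 𝓘(ℝ, EK) 𝓘(ℝ, EE) (fun k : K => quotMk Γ (p <• k)) 1 c : EE) =
      quotDiff EP EE Γ p (fundMap EK K EP p c) :=
    mfderiv_chain (f := fun k : K => p <• k) (g := (quotMk Γ : P → QuotBy P Γ)) (act_one p)
      hPΓ.contMDiff.contMDiffAt (hP.contMDiff_orbit p).contMDiffAt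
      (fun _ => rfl) c
  constructor
  · intro h
    obtain ⟨θ, hθ, hθs⟩ := hP.exists_retraction hPΓ hKΓ.contMDiff p
    have h1 := mfderiv_chain (f := fun k : K => quotMk Γ (p <• k)) (g := θ)
      (h := fun k : K => (k : K ⧸ Γ)) (x := 1) rfl (hθs 1)
      (hPΓ.contMDiff.comp (hP.contMDiff_orbit p)).contMDiffAt (fun k => (hθ k).symm) c
    rw [hπ, h] at h1
    exact h1.trans (map_zero _)
  · intro h
    obtain ⟨j, hj, hjk⟩ := exists_orbitMap hKΓ hP hPΓ p
    have h1 := mfderiv_chain (f := fun k : K => (k : K ⧸ Γ)) (g := j)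
      (h := fun k : K => quotMk Γ (p <• k)) (x := 1) rfl hj.contMDiffAt
      hKΓ.contMDiff.contMDiffAt (fun k => (hjk k).symm) c
    change _ = (mfderiv 𝓘(ℝ, EF) 𝓘(ℝ, EE) j ((1 : K) : K ⧸ Γ) (cosetDiff EK Γ EF c) : EE) at h1
    rw [hπ, h] at h1
    exact h1.trans (map_zero _)

include hPΓ in
/-- The kernel of `T_pP → T(P/Γ)` is vertical for `P → M`. -/
theorem exists_fundMap_of_quotDiff_eq_zero (p : P) (u : EP) (hu : quotDiff EP EE Γ p u = 0) :
    ∃ c : EK, fundMap EK K EP p c = u := by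
  refine hP.exists_fundMap_eq p u ?_
  have h1 := mfderiv_chain (f := (quotMk Γ : P → QuotBy P Γ)) (g := hP.quotProj Γ) (h := pr)
    (x := p) rfl (contMDiffAt_of_comp_submersion hPΓ (g := hP.quotProj Γ) (x := p)
      hP.contMDiff_proj.contMDiffAt) hPΓ.contMDiff.contMDiffAt (fun _ => rfl) u
  change _ = (mfderiv 𝓘(ℝ, EE) 𝓘(ℝ, EM) (hP.quotProj Γ) (quotMk Γ p)
    (quotDiff EP EE Γ p u) : EM) at h1
  rw [hu] at h1
  exact h1.trans (map_zero _)

include hPΓ in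
theorem quotDiff_actDiff (p : P) {γ : K} (hγ : γ ∈ Γ) (u : EP) :
    quotDiff EP EE Γ (p <• γ) (actDiff EP γ p u) = quotDiff EP EE Γ p u :=
  (mfderiv_chain (f := fun q : P => q <• γ) (g := (quotMk Γ : P → QuotBy P Γ)) rfl
    hPΓ.contMDiff.contMDiffAt (hP.contMDiff_translate γ).contMDiffAt
    (fun q => (quotMk_act Γ q hγ).symm) u).symm

/-- Both sides are the derivative at `l = 1` of `p l k = (p k)(k⁻¹ l k)`. -/
theorem fundMap_adMap (p : P) (k : K) (a : EK) :
    fundMap EK K EP (p <• k) (adMap EK k⁻¹ a) = actDiff EP k p (fundMap EK K EP p a) := by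
  have h1 := mfderiv_chain (f := fun l : K => k⁻¹ * l * k⁻¹⁻¹) (g := fun l : K => (p <• k) <• l)
    (h := fun l : K => (p <• l) <• k) (x := 1) (y := 1) (by simp)
    (hP.contMDiff_orbit (p <• k)).contMDiffAt (contMDiff_conj k⁻¹).contMDiffAt
    (fun l => by simp only [act_act]; congr 2; group) a
  have h2 := mfderiv_chain (f := fun l : K => p <• l) (g := fun q : P => q <• k)
    (h := fun l : K => (p <• l) <• k) (x := 1) (y := p) (act_one p)
    (hP.contMDiff_translate k).contMDiffAt (hP.contMDiff_orbit p).contMDiffAt (fun _ => rfl) a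
  exact h1.symm.trans h2

omit hP

include hKΓ in
-- A curve in `Γ` projects to a constant curve in `K/Γ`. Only this inclusion of the Lie algebra in
-- the kernel is needed, not the converse.
theorem cosetDiff_eq_zero_of_mem_lieAlgebraOf {c : EK} (hc : c ∈ lieAlgebraOf EK Γ) :
    cosetDiff EK Γ EF c = 0 := by
  obtain ⟨f, hf, hf0, hfΓ, hfc⟩ := hc
  have h := mfderiv_chain (f := f) (g := fun k : K => (k : K ⧸ Γ))
    (h := fun _ : ℝ => ((1 : K) : K ⧸ Γ)) (x := 0) hf0 hKΓ.contMDiff.contMDiffAt hf.contMDiffAt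
    (fun t => (QuotientGroup.eq.2 (by simpa using hfΓ t))) (1 : ℝ)
  rw [hfc] at h
  exact h.symm.trans (mfderiv_apply_eq_zero (fun _ => rfl) _ _)

variable [IsManifold 𝓘(ℝ, EF) ∞ (K ⧸ Γ)]

include hKΓ in
/-- The value of an invariant form at the base point is `Ad(Γ)`-invariant. -/
theorem valueAtBase_adMap {ξ : OneForm EF (K ⧸ Γ) ℝ} (hξ : IsInvariant ξ) {γ : K} (hγ : γ ∈ Γ)
    (a : EK) : valueAtBase (EK := EK) ξ (adMap EK γ a) = valueAtBase (EK := EK) ξ a := by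
  have hb : γ • ((1 : K) : K ⧸ Γ) = ((1 : K) : K ⧸ Γ) := by
    exact QuotientGroup.eq.2 (by simpa using hγ)
  -- Since `[γ l γ⁻¹] = γ • [l]`, the map `Ad γ` covers the differential of the left translation by
  -- `γ` at its fixed point `[1]`.
  have h1 := mfderiv_chain (f := fun l : K => γ * l * γ⁻¹) (g := fun k : K => (k : K ⧸ Γ))
    (h := fun l : K => γ • (l : K ⧸ Γ)) (x := 1) (y := 1) (by simp)
    hKΓ.contMDiff.contMDiffAt (contMDiff_conj γ).contMDiffAt
    (fun l => (QuotientGroup.mk_mul_of_mem (γ * l) (Γ.inv_mem hγ)).symm) a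
  have h2 := mfderiv_chain (f := fun l : K => (l : K ⧸ Γ)) (g := fun z : K ⧸ Γ => γ • z)
    (h := fun l : K => γ • (l : K ⧸ Γ)) (x := 1) rfl
    (contMDiff_leftSMul hKΓ γ).contMDiffAt hKΓ.contMDiff.contMDiffAt
    (fun _ => rfl) a
  have h3 := hξ γ ((1 : K) : K ⧸ Γ) (cosetDiff EK Γ EF a)
  refine Eq.trans ?_ h3
  have e : ∀ (y y' : K ⧸ Γ) (_ : y = y') (w : EF),
      (ξ y : EF →L[ℝ] ℝ) w = (ξ y' : EF →L[ℝ] ℝ) w := by rintro y _ rfl w; rfl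
  refine Eq.trans ?_ (e _ _ hb.symm _)
  exact congrArg (ξ ((1 : K) : K ⧸ Γ) : EF →L[ℝ] ℝ) (h1.symm.trans h2)

include hKΓ in
/-- An invariant form is determined by its value at the base point. -/
theorem apply_leftSMul_cosetDiff {ξ : OneForm EF (K ⧸ Γ) ℝ} (hξ : IsInvariant ξ) (k : K) (a : EK) :
    (ξ (k : K ⧸ Γ) : EF →L[ℝ] ℝ)
      (mfderiv 𝓘(ℝ, EK) 𝓘(ℝ, EF) (fun l : K => ((k * l : K) : K ⧸ Γ)) 1 a : EF) =
    valueAtBase (EK := EK) ξ a := by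
  have h2 := mfderiv_chain (f := fun l : K => (l : K ⧸ Γ)) (g := fun z : K ⧸ Γ => k • z)
    (h := fun l : K => ((k * l : K) : K ⧸ Γ)) (x := 1) rfl
    (contMDiff_leftSMul hKΓ k).contMDiffAt hKΓ.contMDiff.contMDiffAt
    (fun _ => rfl) a
  have h3 := hξ k ((1 : K) : K ⧸ Γ) (cosetDiff EK Γ EF a)
  refine Eq.trans ?_ h3
  have hb : k • ((1 : K) : K ⧸ Γ) = (k : K ⧸ Γ) := by
    change ((k * 1 : K) : K ⧸ Γ) = k
    rw [mul_one]
  have e : ∀ (y y' : K ⧸ Γ) (_ : y = y') (w : EF),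
      (ξ y : EF →L[ℝ] ℝ) w = (ξ y' : EF →L[ℝ] ℝ) w := by rintro y _ rfl w; rfl
  refine Eq.trans ?_ (e _ _ hb.symm _)
  exact congrArg (ξ (k : K ⧸ Γ) : EF →L[ℝ] ℝ) h2

theorem valueAtBase_eq_zero {ξ : OneForm EF (K ⧸ Γ) ℝ} {c : EK} (hc : cosetDiff EK Γ EF c = 0) :
    valueAtBase (EK := EK) ξ c = 0 :=
  (congrArg (ξ ((1 : K) : K ⧸ Γ) : EF →L[ℝ] ℝ) hc).trans (map_zero _)

theorem valueAtBase_add (ξ : OneForm EF (K ⧸ Γ) ℝ) (a b : EK) :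
    valueAtBase (EK := EK) ξ (a + b : EK) =
      valueAtBase (EK := EK) ξ a + valueAtBase (EK := EK) ξ b :=
  map_add ((ξ ((1 : K) : K ⧸ Γ) : EF →L[ℝ] ℝ).comp (cosetDiff EK Γ EF)) a b

variable [IsManifold 𝓘(ℝ, EP) ∞ P] (A : PrincipalConnection EK K EP P)

theorem PrincipalConnection.form_fundMap (p : P) (a : EK) :
    (A.form p : EP →L[ℝ] EK) (fundMap EK K EP p a) = a :=
  A.form_fundVec p a

theorem PrincipalConnection.form_actDiff (p : P) (k : K) (u : EP) :
    (A.form (p <• k) : EP →L[ℝ] EK) (actDiff EP k p u) =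
      adMap EK k⁻¹ ((A.form p : EP →L[ℝ] EK) u) :=
  A.form_act p k u

include hKΓ hP hPΓ in
/-- The vertical part in `T(P/Γ)` and the value of `ξ₀ ∘ ω` depend only on the image in `T(P/Γ)` of
a tangent vector of `P`. -/
theorem PrincipalConnection.eq_of_quotDiff_eq {ξ : OneForm EF (K ⧸ Γ) ℝ} (hξ : IsInvariant ξ)
    {p q : P} {u w : EP} (hpq : quotMk Γ p = quotMk Γ q)
    (h : quotDiff EP EE Γ p u = quotDiff EP EE Γ q w) :
    quotDiff EP EE Γ p (fundMap EK K EP p ((A.form p : EP →L[ℝ] EK) u)) =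
      quotDiff EP EE Γ q (fundMap EK K EP q ((A.form q : EP →L[ℝ] EK) w)) ∧
    valueAtBase (EK := EK) ξ ((A.form p : EP →L[ℝ] EK) u) =
      valueAtBase (EK := EK) ξ ((A.form q : EP →L[ℝ] EK) w) := by
  obtain ⟨γ, hγ, rfl⟩ := exists_of_quotMk_eq hpq
  -- After translation by `γ` both lifts sit at the same point of `P`, so they differ by a kernel
  -- vector `σ(c)` with `c` killed in `T(K/Γ)`.
  have h0 : quotDiff EP EE Γ (p <• γ) (w - actDiff EP γ p u) = 0 := by
    rw [map_sub, quotDiff_actDiff hP hPΓ p hγ, h, sub_self]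
  obtain ⟨c, hc⟩ := exists_fundMap_of_quotDiff_eq_zero hP hPΓ _ _ h0
  have hw : w = actDiff EP γ p u + fundMap EK K EP (p <• γ) c := by rw [hc]; abel
  have hcd : cosetDiff EK Γ EF c = 0 :=
    (quotDiff_fundMap_eq_zero_iff hKΓ hP hPΓ (p <• γ) c).1 (by rw [hc, h0])
  have hω : (A.form (p <• γ) : EP →L[ℝ] EK) w =
      adMap EK γ⁻¹ ((A.form p : EP →L[ℝ] EK) u) + c := by
    rw [hw]
    refine (map_add (A.form (p <• γ) : EP →L[ℝ] EK) _ _).trans ?_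
    rw [A.form_actDiff, A.form_fundMap]
  rw [hω]
  constructor
  · rw [map_add, map_add, hc, h0, add_zero, fundMap_adMap hP, quotDiff_actDiff hP hPΓ p hγ]
  · rw [valueAtBase_add, valueAtBase_eq_zero hcd, add_zero,
      valueAtBase_adMap hKΓ hξ (Γ.inv_mem hγ)]

end Differentials

/-! ### The induced connection, the function on vertical vectors and the descended form. -/

section Quotient

variable {EK : Type*} [NormedAddCommGroup EK] [NormedSpace ℝ EK]
  {K : Type*} [TopologicalSpace K] [ChartedSpace EK K] [Group K] [LieGroup 𝓘(ℝ, EK) ∞ K]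
  {EM : Type*} [NormedAddCommGroup EM] [NormedSpace ℝ EM]
  {M : Type*} [TopologicalSpace M] [ChartedSpace EM M]
  {EP : Type*} [NormedAddCommGroup EP] [NormedSpace ℝ EP]
  {P : Type*} [TopologicalSpace P] [ChartedSpace EP P] [IsManifold 𝓘(ℝ, EP) ∞ P]
  [MulAction Kᵐᵒᵖ P]
  {EE : Type*} [NormedAddCommGroup EE] [NormedSpace ℝ EE]
  {Γ : Subgroup K} [ChartedSpace EE (QuotBy P Γ)]
  {EF : Type*} [NormedAddCommGroup EF] [NormedSpace ℝ EF]
  [ChartedSpace EF (K ⧸ Γ)] [IsManifold 𝓘(ℝ, EF) ∞ (K ⧸ Γ)]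
  {pr : P → M}
  (hKΓ : Manifold.IsSubmersion 𝓘(ℝ, EK) 𝓘(ℝ, EF) ∞ (fun k : K => (k : K ⧸ Γ)))
  (hP : IsPrincipalBundle EK K EM EP pr)
  (hPΓ : Manifold.IsSubmersion 𝓘(ℝ, EP) 𝓘(ℝ, EE) ∞ (quotMk Γ : P → QuotBy P Γ))
  (A : PrincipalConnection EK K EP P)
  {ξ : OneForm EF (K ⧸ Γ) ℝ} (hξ : IsInvariant ξ)

/-- This trades an equality in the tangent bundle, whose fibres depend on the base point, for two
equalities in fixed types. -/
theorem tangentQuotMk_eq_iff (p q : P) (u w : EP) :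
    tangentQuotMk EP EE Γ ⟨p, u⟩ = tangentQuotMk EP EE Γ ⟨q, w⟩ ↔
      quotMk Γ p = quotMk Γ q ∧ quotDiff EP EE Γ p u = quotDiff EP EE Γ q w := by
  constructor
  · intro h
    exact ⟨congrArg TotalSpace.proj h, congrArg (fun v => (v.2 : EE)) h⟩
  · rintro ⟨h1, h2⟩
    have e : ∀ (y y' : QuotBy P Γ) (_ : y = y') (v v' : EE) (_ : v = v'),
        (⟨y, v⟩ : TangentBundle 𝓘(ℝ, EE) (QuotBy P Γ)) = ⟨y', v'⟩ := by
      rintro y _ rfl v _ rfl; rfl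
    exact e _ _ h1 _ _ h2

include hPΓ in
theorem exists_tangentQuotMk_eq (v : TangentBundle 𝓘(ℝ, EE) (QuotBy P Γ)) :
    ∃ (p : P) (u : EP), tangentQuotMk EP EE Γ ⟨p, u⟩ = v := by
  obtain ⟨y, v⟩ := v
  obtain ⟨p, rfl⟩ : ∃ p, quotMk Γ p = y := Quotient.exists_rep y
  obtain ⟨u, hu⟩ := mfderiv_surjective_of_submersion hPΓ hPΓ.contMDiff p v
  refine ⟨p, u, ?_⟩
  change (⟨quotMk Γ p, quotDiff EP EE Γ p u⟩ : TangentBundle 𝓘(ℝ, EE) (QuotBy P Γ)) = _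
  congr 1

include hKΓ hP hPΓ hξ

/-- The induced operator on `T(P/Γ)` is well defined. -/
theorem PrincipalConnection.induced_tangentQuotMk (w : TangentBundle 𝓘(ℝ, EP) P) :
    A.induced EE Γ (tangentQuotMk EP EE Γ w) = tangentQuotMk EP EE Γ (A.verticalProj w) := by
  have h : ∃ w', tangentQuotMk EP EE Γ w' = tangentQuotMk EP EE Γ w := ⟨w, rfl⟩
  rw [PrincipalConnection.induced, dif_pos h]
  obtain ⟨h1, h2⟩ := (tangentQuotMk_eq_iff _ _ _ _).1 h.choose_spec
  exact (tangentQuotMk_eq_iff _ _ _ _).2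
    ⟨h1, (A.eq_of_quotDiff_eq hKΓ hP hPΓ hξ h1 h2).1⟩

include A in
/-- The function on the vertical bundle defined by an invariant form is well defined. -/
theorem alphaTilde_tangentQuotMk (𝔪 : Submodule ℝ (GroupLieAlgebra 𝓘(ℝ, EK) K)) (p : P) {b : EK}
    (hb : b ∈ 𝔪) :
    alphaTilde (EK := EK) EP ξ 𝔪 (tangentQuotMk EP EE Γ ⟨p, fundMap EK K EP p b⟩) =
      valueAtBase (EK := EK) ξ b := by
  have h : ∃ b' : P × GroupLieAlgebra 𝓘(ℝ, EK) K, b'.2 ∈ 𝔪 ∧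
      tangentQuotMk EP EE Γ ⟨b'.1, fundVec EP b'.1 b'.2⟩ =
        tangentQuotMk EP EE Γ ⟨p, fundMap EK K EP p b⟩ := ⟨(p, b), hb, rfl⟩
  rw [alphaTilde, dif_pos h]
  obtain ⟨h1, h2⟩ := (tangentQuotMk_eq_iff _ _ _ _).1 h.choose_spec.2
  -- The chosen pair need not be `(p, b)`, but `ξ₀ ∘ ω` agrees on the two lifts and `ω` recovers the
  -- generator from each fundamental vector.
  have h3 := (A.eq_of_quotDiff_eq hKΓ hP hPΓ hξ h1 h2).2
  rw [A.form_fundMap] at h3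
  refine Eq.trans ?_ h3
  congr 1
  exact (A.form_fundMap h.choose.1 h.choose.2).symm

/-- On the image of `w ∈ T_pP` the composition of the two maps is `ξ₀(ω(w))`. -/
theorem alphaTilde_induced {𝔪 : Submodule ℝ (GroupLieAlgebra 𝓘(ℝ, EK) K)}
    (h𝔪 : IsCompl (lieAlgebraOf EK Γ) 𝔪) (p : P) (u : EP) :
    alphaTilde (EK := EK) EP ξ 𝔪 (A.induced EE Γ (tangentQuotMk EP EE Γ ⟨p, u⟩)) =
      valueAtBase (EK := EK) ξ ((A.form p : EP →L[ℝ] EK) u) := by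
  rw [A.induced_tangentQuotMk hKΓ hP hPΓ hξ]
  obtain ⟨c, b, hc, hb, hcb⟩ : ∃ c b : EK, c ∈ lieAlgebraOf EK Γ ∧ b ∈ 𝔪 ∧
      (A.form p : EP →L[ℝ] EK) u = c + b := by
    have htop : ∀ a : GroupLieAlgebra 𝓘(ℝ, EK) K, a ∈ lieAlgebraOf EK Γ ⊔ 𝔪 := fun a => by
      rw [h𝔪.sup_eq_top]; trivial
    obtain ⟨c, hc, b, hb, h⟩ := Submodule.mem_sup.1 (htop ((A.form p : EP →L[ℝ] EK) u))
    exact ⟨c, b, hc, hb, h.symm⟩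
  have hcd : cosetDiff EK Γ EF c = 0 := cosetDiff_eq_zero_of_mem_lieAlgebraOf hKΓ hc
  have h1 : tangentQuotMk EP EE Γ (A.verticalProj ⟨p, u⟩) =
      tangentQuotMk EP EE Γ ⟨p, fundMap EK K EP p b⟩ := by
    refine (tangentQuotMk_eq_iff p p (fundMap EK K EP p ((A.form p : EP →L[ℝ] EK) u)) _).2
      ⟨rfl, ?_⟩
    rw [hcb, map_add, map_add, (quotDiff_fundMap_eq_zero_iff hKΓ hP hPΓ p c).2 hcd, zero_add]
  rw [h1, alphaTilde_tangentQuotMk hKΓ hP hPΓ A hξ 𝔪 p hb, hcb, valueAtBase_add,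
    valueAtBase_eq_zero hcd, zero_add]

variable [IsManifold 𝓘(ℝ, EE) ∞ (QuotBy P Γ)]

/-- The form `ξ₀ ∘ ω` on `P` descends to a smooth form on `P/Γ`. -/
theorem exists_descended_form : ∃ α : OneForm EE (QuotBy P Γ) ℝ, ∀ (p : P) (u : EP),
    (α (quotMk Γ p) : EE →L[ℝ] ℝ) (quotDiff EP EE Γ p u) =
      valueAtBase (EK := EK) ξ ((A.form p : EP →L[ℝ] EK) u) := by
  have hex : ∀ y : QuotBy P Γ, ∃ s : QuotBy P Γ → P,
      ContMDiffAt 𝓘(ℝ, EE) 𝓘(ℝ, EP) ∞ s y ∧ ∀ᶠ z in nhds y, quotMk Γ (s z) = z := by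
    intro y
    obtain ⟨p, rfl⟩ : ∃ p, quotMk Γ p = y := Quotient.exists_rep y
    obtain ⟨s, -, h1, h2⟩ := exists_localSection hPΓ p
    exact ⟨s, h1, h2⟩
  choose s hs hsec using hex
  let L : EK →L[ℝ] ℝ := (ξ ((1 : K) : K ⧸ Γ) : EF →L[ℝ] ℝ).comp (cosetDiff EK Γ EF)
  -- Each `y` uses its own section `s y`, only at `y`; by `hα` below the value does not depend on
  -- this choice.
  let α₀ : ∀ y : QuotBy P Γ, EE →L[ℝ] ℝ := fun y =>
    L.comp ((A.form (s y y) : EP →L[ℝ] EK).comp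
      (mfderiv 𝓘(ℝ, EE) 𝓘(ℝ, EP) (s y) y : EE →L[ℝ] EP))
  have hlift : ∀ (t : QuotBy P Γ → P) (y : QuotBy P Γ), MDifferentiableAt 𝓘(ℝ, EE) 𝓘(ℝ, EP) t y →
      (∀ᶠ z in nhds y, quotMk Γ (t z) = z) → ∀ v : EE, quotDiff EP EE Γ (t y)
        (mfderiv 𝓘(ℝ, EE) 𝓘(ℝ, EP) t y v : EP) = v := fun t y ht hty v =>
    mfderiv_comp_localSection (hPΓ.contMDiff.mdifferentiable (by simp) _) ht hty v
  have hα : ∀ (p : P) (u : EP), α₀ (quotMk Γ p) (quotDiff EP EE Γ p u) =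
      valueAtBase (EK := EK) ξ ((A.form p : EP →L[ℝ] EK) u) := fun p u =>
    (A.eq_of_quotDiff_eq hKΓ hP hPΓ hξ (hsec (quotMk Γ p)).self_of_nhds
      (hlift _ _ ((hs _).mdifferentiableAt (by simp)) (hsec _) _)).2
  have hsmooth : ∀ y, ContMDiffAt 𝓘(ℝ, EE) (𝓘(ℝ, EE).prod 𝓘(ℝ, EE →L[ℝ] ℝ)) ∞ (fun x =>
      TotalSpace.mk' (EE →L[ℝ] ℝ) (E := fun x : QuotBy P Γ =>
        TangentSpace 𝓘(ℝ, EE) x →L[ℝ] Trivial (QuotBy P Γ) ℝ x) x (α₀ x)) y := by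
    intro y
    -- For smoothness at `y` the single section `s y` serves all nearby `z`, where `hα` rewrites `α₀
    -- z` as the pullback of the form on `P` along `s y`.
    refine contMDiffAt_comp_pullback (hs y) A.form L ?_
    -- Differentiability of `s y` at the nearby points suffices, and finite order 1 is what spreads
    -- from `y` to a neighbourhood.
    have h1 : ∀ᶠ z in nhds y, ContMDiffAt 𝓘(ℝ, EE) 𝓘(ℝ, EP) 1 (s y) z := by
      have : IsManifold 𝓘(ℝ, EE) 1 (QuotBy P Γ) := IsManifold.of_le (n := ∞) (by simp)
      have : IsManifold 𝓘(ℝ, EP) 1 P := IsManifold.of_le (n := ∞) (by simp)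
      exact (contMDiffAt_iff_contMDiffAt_nhds (by simp)).1 ((hs y).of_le (by simp))
    filter_upwards [h1, (hsec y).eventually_nhds] with z hz hz' v
    have h2 := hα (s y z) (mfderiv 𝓘(ℝ, EE) 𝓘(ℝ, EP) (s y) z v : EP)
    rw [hlift _ _ (hz.mdifferentiableAt (by simp)) hz', hz'.self_of_nhds] at h2
    exact h2
  exact ⟨⟨α₀, hsmooth⟩, hα⟩

/-! ### The fibres of `P/Γ → M` and the restriction of the form. -/

omit hξ

/-- The identification of the fibre of `P/Γ` through the class of `p` with `K/Γ`. -/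
theorem exists_fiber_diffeomorph (x : M) [ChartedSpace EF (hP.Fiber Γ x)]
    [IsManifold 𝓘(ℝ, EF) ∞ (hP.Fiber Γ x)]
    (hι : Manifold.IsSmoothEmbedding 𝓘(ℝ, EF) 𝓘(ℝ, EE) ∞
      (Subtype.val : hP.Fiber Γ x → QuotBy P Γ)) (p : P) (hp : pr p = x) :
    ∃ η : hP.Fiber Γ x ≃ₘ^∞⟮𝓘(ℝ, EF), 𝓘(ℝ, EF)⟯ (K ⧸ Γ),
      (∀ (k : K) (y : hP.Fiber Γ x), y.1 = quotMk Γ (p <• k) → η y = (k : K ⧸ Γ)) ∧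
      ∀ k : K, (η.symm (k : K ⧸ Γ)).1 = quotMk Γ (p <• k) := by
  obtain ⟨θ, hθ, hθs⟩ := hP.exists_retraction hPΓ hKΓ.contMDiff p
  obtain ⟨j, hj, hjk⟩ := exists_orbitMap hKΓ hP hPΓ p
  have hjx : ∀ z, hP.quotProj Γ (j z) = x := by
    intro z
    obtain ⟨k, rfl⟩ := QuotientGroup.mk_surjective z
    rw [hjk]
    exact (hP.proj_act p k).trans hp
  have hrep : ∀ y : hP.Fiber Γ x, ∃ k : K, y.1 = quotMk Γ (p <• k) := by
    rintro ⟨y, hy⟩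
    obtain ⟨q, rfl⟩ : ∃ q, quotMk Γ q = y := Quotient.exists_rep y
    obtain ⟨k, rfl⟩ := hP.exists_act_eq (p := p) (q := q) (Eq.trans hy hp.symm)
    exact ⟨k, rfl⟩
  let η : hP.Fiber Γ x ≃ₘ^∞⟮𝓘(ℝ, EF), 𝓘(ℝ, EF)⟯ (K ⧸ Γ) :=
    { toFun := fun y => θ y.1
      invFun := fun z => ⟨j z, hjx z⟩
      left_inv := fun y => by
        obtain ⟨k, hk⟩ := hrep y
        apply Subtype.ext
        change j (θ y.1) = y.1
        rw [hk, hθ, hjk]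
      right_inv := fun z => by
        obtain ⟨k, rfl⟩ := QuotientGroup.mk_surjective z
        change θ (j k) = k
        rw [hjk, hθ]
      contMDiff_toFun := fun y => by
        obtain ⟨k, hk⟩ := hrep y
        exact ContMDiffAt.comp y (g := θ) (hk ▸ hθs k) hι.contMDiff.contMDiffAt
      contMDiff_invFun :=
        -- Composed with the inclusion of the fibre, the inverse is the orbit map `j`, and
        -- smoothness into the fibre can be tested through the immersion.
        (ContMDiff.iff_comp_isImmersion hι.isImmersion).2
          ⟨hj.continuous.subtype_mk hjx, hj⟩ }
  refine ⟨η, fun k y hy => ?_, fun k => hjk k⟩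
  change θ y.1 = k
  rw [hy, hθ]

include hξ in
/-- The restriction of the descended form to a fibre is the pullback of the invariant form. -/
theorem pullback_val_eq_pullback_diffeomorph {α : OneForm EE (QuotBy P Γ) ℝ}
    (hα : ∀ (p : P) (u : EP), (α (quotMk Γ p) : EE →L[ℝ] ℝ) (quotDiff EP EE Γ p u) =
      valueAtBase (EK := EK) ξ ((A.form p : EP →L[ℝ] EK) u))
    (x : M) [ChartedSpace EF (hP.Fiber Γ x)] [IsManifold 𝓘(ℝ, EF) ∞ (hP.Fiber Γ x)]
    (hι : ContMDiff 𝓘(ℝ, EF) 𝓘(ℝ, EE) ∞ (Subtype.val : hP.Fiber Γ x → QuotBy P Γ)) (p : P)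
    (η : hP.Fiber Γ x ≃ₘ^∞⟮𝓘(ℝ, EF), 𝓘(ℝ, EF)⟯ (K ⧸ Γ))
    (hη : ∀ k : K, (η.symm (k : K ⧸ Γ)).1 = quotMk Γ (p <• k)) :
    pullback ⟨Subtype.val, hι⟩ α = pullback η.toContMDiffMap ξ := by
  ext y v
  obtain ⟨k, hk⟩ := QuotientGroup.mk_surjective (η y)
  have hy : η.symm (k : K ⧸ Γ) = y := by rw [hk, η.symm_apply_apply]
  let w : EF := mfderiv 𝓘(ℝ, EF) 𝓘(ℝ, EF) η y v
  have hkl : ContMDiff 𝓘(ℝ, EK) 𝓘(ℝ, EF) ∞ fun l : K => ((k * l : K) : K ⧸ Γ) :=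
    hKΓ.contMDiff.comp (contMDiff_leftMul k)
  -- The vector `w` is lifted to `T_kK` and moved to the identity by left translation. The same `c`
  -- then describes `v` in `P/Γ` (`h3`) and `w` in `K/Γ`.
  obtain ⟨c, hc⟩ : ∃ c : EK,
      (mfderiv 𝓘(ℝ, EK) 𝓘(ℝ, EF) (fun l : K => ((k * l : K) : K ⧸ Γ)) 1 c : EF) = w := by
    obtain ⟨c', hc'⟩ := mfderiv_surjective_of_submersion hKΓ hKΓ.contMDiff k w
    refine ⟨mfderiv 𝓘(ℝ, EK) 𝓘(ℝ, EK) (fun l : K => k⁻¹ * l) k c', ?_⟩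
    rw [← hc']
    exact (mfderiv_chain (f := fun l : K => k⁻¹ * l) (g := fun l : K => ((k * l : K) : K ⧸ Γ))
      (h := fun l : K => (l : K ⧸ Γ)) (x := k) (inv_mul_cancel k) hkl.contMDiffAt
      (contMDiff_leftMul k⁻¹).contMDiffAt (fun l => by rw [mul_inv_cancel_left]) c').symm
  have h1 : (mfderiv 𝓘(ℝ, EF) 𝓘(ℝ, EF) η.symm (η y) w : EF) = v :=
    (mfderiv_chain (f := η) (g := η.symm) (h := fun z => η.symm (η z)) (x := y) rfl
      η.symm.contMDiff.contMDiffAt η.contMDiff.contMDiffAt (fun _ => rfl) v).symm.trans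
      (mfderiv_apply_eq_self (E := EF) η.symm_apply_apply y v)
  have h2 : (mfderiv 𝓘(ℝ, EK) 𝓘(ℝ, EF) (fun l : K => η.symm ((k * l : K) : K ⧸ Γ)) 1 c : EF) =
      v := by
    rw [← h1, ← hc]
    exact mfderiv_chain (f := fun l : K => ((k * l : K) : K ⧸ Γ)) (g := η.symm)
      (x := 1) (by rw [mul_one, hk]) η.symm.contMDiff.contMDiffAt hkl.contMDiffAt (fun _ => rfl) c
  have h3 : (mfderiv 𝓘(ℝ, EF) 𝓘(ℝ, EE) (Subtype.val : hP.Fiber Γ x → QuotBy P Γ) y v : EE) =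
      quotDiff EP EE Γ (p <• k) (fundMap EK K EP (p <• k) c) := by
    have h4 := mfderiv_chain (f := fun l : K => η.symm ((k * l : K) : K ⧸ Γ))
      (g := (Subtype.val : hP.Fiber Γ x → QuotBy P Γ))
      (h := fun l : K => quotMk Γ ((p <• k) <• l)) (x := 1) (by rw [mul_one, hy]) hι.contMDiffAt
      (η.symm.contMDiff.comp hkl).contMDiffAt (fun l => by rw [act_act, hη]) c
    rw [h2] at h4
    exact h4.symm.trans (mfderiv_chain (f := fun l : K => (p <• k) <• l)
      (g := (quotMk Γ : P → QuotBy P Γ)) (act_one _) hPΓ.contMDiff.contMDiffAt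
      (hP.contMDiff_orbit _).contMDiffAt (fun _ => rfl) c)
  have e1 : ∀ (z z' : QuotBy P Γ) (_ : z = z') (u : EE),
      (α z : EE →L[ℝ] ℝ) u = (α z' : EE →L[ℝ] ℝ) u := by rintro z _ rfl u; rfl
  have e2 : ∀ (z z' : K ⧸ Γ) (_ : z = z') (u : EF),
      (ξ z : EF →L[ℝ] ℝ) u = (ξ z' : EF →L[ℝ] ℝ) u := by rintro z _ rfl u; rfl
  have h5 : (α y.1 : EE →L[ℝ] ℝ)
      (mfderiv 𝓘(ℝ, EF) 𝓘(ℝ, EE) (Subtype.val : hP.Fiber Γ x → QuotBy P Γ) y v : EE) =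
      valueAtBase (EK := EK) ξ c := by
    rw [h3, e1 _ _ (show y.1 = quotMk Γ (p <• k) by rw [← hy, hη]), hα, A.form_fundMap]
  have h6 : (ξ (η y) : EF →L[ℝ] ℝ) w = valueAtBase (EK := EK) ξ c := by
    rw [← apply_leftSMul_cosetDiff hKΓ hξ k c, hc]
    exact e2 _ _ hk.symm w
  exact h5.trans h6.symm

end Quotient

end

end HGB

theorem theorem4
    {EK : Type*} [NormedAddCommGroup EK] [NormedSpace ℝ EK] [FiniteDimensional ℝ EK]
    {K : Type*} [TopologicalSpace K] [ChartedSpace EK K] [Group K] [LieGroup 𝓘(ℝ, EK) ∞ K]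
    [T2Space K] [CompactSpace K] [ConnectedSpace K]
    (Γ : Subgroup K) (hΓ : IsClosed (Γ : Set K))
    -- the homogeneous space `K/Γ` with its smooth structure
    {EF : Type*} [NormedAddCommGroup EF] [NormedSpace ℝ EF] [FiniteDimensional ℝ EF]
    [ChartedSpace EF (K ⧸ Γ)] [IsManifold 𝓘(ℝ, EF) ∞ (K ⧸ Γ)]
    (hKΓ : Manifold.IsSubmersion 𝓘(ℝ, EK) 𝓘(ℝ, EF) ∞ (fun k : K => (k : K ⧸ Γ)))
    -- the principal bundle `P → M` with structure group `K`
    {EM : Type*} [NormedAddCommGroup EM] [NormedSpace ℝ EM] [FiniteDimensional ℝ EM]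
    {M : Type*} [TopologicalSpace M] [ChartedSpace EM M] [IsManifold 𝓘(ℝ, EM) ∞ M]
    {EP : Type*} [NormedAddCommGroup EP] [NormedSpace ℝ EP] [FiniteDimensional ℝ EP]
    {P : Type*} [TopologicalSpace P] [ChartedSpace EP P] [IsManifold 𝓘(ℝ, EP) ∞ P]
    [MulAction Kᵐᵒᵖ P]
    (pr : P → M) (hP : HGB.IsPrincipalBundle EK K EM EP pr)
    -- the quotient `P/Γ` with its smooth structure
    {EE : Type*} [NormedAddCommGroup EE] [NormedSpace ℝ EE] [FiniteDimensional ℝ EE]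
    [ChartedSpace EE (HGB.QuotBy P Γ)] [IsManifold 𝓘(ℝ, EE) ∞ (HGB.QuotBy P Γ)]
    (hPΓ : Manifold.IsSubmersion 𝓘(ℝ, EP) 𝓘(ℝ, EE) ∞ (HGB.quotMk Γ : P → HGB.QuotBy P Γ))
    -- the connection on `P`
    (A : HGB.PrincipalConnection EK K EP P)
    -- the reductive decomposition of the Lie algebra of `K`
    (𝔪 : Submodule ℝ (GroupLieAlgebra 𝓘(ℝ, EK) K))
    (h𝔪 : IsCompl (HGB.lieAlgebraOf EK Γ) 𝔪)
    (hAd : ∀ γ ∈ Γ, ∀ b ∈ 𝔪, HGB.Ad EK γ b ∈ 𝔪)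
    -- the cohomology class `a` and the invariant form `ξ` that represents it
    (a : HGB.H1 EF (K ⧸ Γ)) (ξ : HGB.OneForm EF (K ⧸ Γ) ℝ) (hξ : HGB.IsInvariant ξ)
    (hclosed : ξ ∈ HGB.closedForms EF (K ⧸ Γ)) (ha : HGB.H1.mk ξ hclosed = a) :
    -- the induced connection form and the form on the vertical bundle are well defined
    (∀ w : TangentBundle 𝓘(ℝ, EP) P,
      A.induced EE Γ (HGB.tangentQuotMk EP EE Γ w) =
        HGB.tangentQuotMk EP EE Γ (A.verticalProj w)) ∧
    (∀ (p : P), ∀ b ∈ 𝔪,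
      HGB.alphaTilde EP ξ 𝔪 (HGB.tangentQuotMk EP EE Γ ⟨p, HGB.fundVec EP p b⟩) =
        HGB.valueAtBase ξ b) ∧
    -- their composition is a smooth 1-form `α` on `P/Γ` ...
    ∃ α : HGB.OneForm EE (HGB.QuotBy P Γ) ℝ,
      (∀ v : TangentBundle 𝓘(ℝ, EE) (HGB.QuotBy P Γ),
        α v.proj v.2 = HGB.alphaTilde EP ξ 𝔪 (A.induced EE Γ v)) ∧
      -- ... that vanishes on the horizontal distribution ...
      (∀ v ∈ A.horizontal EE Γ, α v.proj v.2 = (0 : ℝ)) ∧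
      -- ... and whose restriction to each fibre, an embedded submanifold of `P/Γ`, is closed,
      -- equal to the pullback of `ξ`, and in the class of the pullback of `a`,
      -- for the identification of the fibre with `K/Γ` that any point `p` of `P` over `x` gives
      ∀ (x : M) [ChartedSpace EF (hP.Fiber Γ x)] [IsManifold 𝓘(ℝ, EF) ∞ (hP.Fiber Γ x)]
        (hι : Manifold.IsSmoothEmbedding 𝓘(ℝ, EF) 𝓘(ℝ, EE) ∞
          (Subtype.val : hP.Fiber Γ x → HGB.QuotBy P Γ)),
        ∃ hα : HGB.pullback ⟨Subtype.val, hι.contMDiff⟩ α ∈ HGB.closedForms EF (hP.Fiber Γ x),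
          ∀ p : P, pr p = x →
            ∃ η : hP.Fiber Γ x ≃ₘ^∞⟮𝓘(ℝ, EF), 𝓘(ℝ, EF)⟯ (K ⧸ Γ),
              (∀ (k : K) (y : hP.Fiber Γ x),
                y.1 = HGB.quotMk Γ (p <• k) → η y = (k : K ⧸ Γ)) ∧
              HGB.pullback ⟨Subtype.val, hι.contMDiff⟩ α = HGB.pullback η.toContMDiffMap ξ ∧
              HGB.H1.mk (HGB.pullback ⟨Subtype.val, hι.contMDiff⟩ α) hα =
                HGB.H1.map η.toContMDiffMap a := by
  obtain ⟨α, hα⟩ := HGB.exists_descended_form hKΓ hP hPΓ A hξ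
  have hα' : ∀ v : TangentBundle 𝓘(ℝ, EE) (HGB.QuotBy P Γ),
      α v.proj v.2 = HGB.alphaTilde EP ξ 𝔪 (A.induced EE Γ v) := by
    intro v
    obtain ⟨p, u, rfl⟩ := HGB.exists_tangentQuotMk_eq hPΓ v
    exact (hα p u).trans (HGB.alphaTilde_induced hKΓ hP hPΓ A hξ h𝔪 p u).symm
  refine ⟨A.induced_tangentQuotMk hKΓ hP hPΓ hξ, fun p b hb =>
    HGB.alphaTilde_tangentQuotMk hKΓ hP hPΓ A hξ 𝔪 p hb, α, hα', ?_, ?_⟩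
  · rintro _ ⟨⟨p, u⟩, hu, rfl⟩
    refine (hα p u).trans (HGB.valueAtBase_eq_zero ?_)
    exact (congrArg (HGB.cosetDiff EK Γ EF) hu).trans (map_zero _)
  · intro x _ _ hι
    have key : ∀ p : P, pr p = x → ∃ η : hP.Fiber Γ x ≃ₘ^∞⟮𝓘(ℝ, EF), 𝓘(ℝ, EF)⟯ (K ⧸ Γ),
        (∀ (k : K) (y : hP.Fiber Γ x),
          y.1 = HGB.quotMk Γ (p <• k) → η y = (k : K ⧸ Γ)) ∧
        HGB.pullback ⟨Subtype.val, hι.contMDiff⟩ α = HGB.pullback η.toContMDiffMap ξ := by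
      intro p hp
      obtain ⟨η, h1, h2⟩ := HGB.exists_fiber_diffeomorph hKΓ hP hPΓ x hι p hp
      exact ⟨η, h1, HGB.pullback_val_eq_pullback_diffeomorph hKΓ hP hPΓ A hξ hα x
        hι.contMDiff p η h2⟩
    -- Closedness concerns the fibre alone, so one identification, from any point over `x`, proves
    -- it before `p` is fixed.
    obtain ⟨p₀, hp₀⟩ := hP.exists_proj_eq x
    obtain ⟨η₀, -, h₀⟩ := key p₀ hp₀
    have hcl : HGB.pullback ⟨Subtype.val, hι.contMDiff⟩ α ∈ HGB.closedForms EF (hP.Fiber Γ x) := by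
      rw [h₀]
      exact HGB.pullback_mem_closedForms _ hclosed
    refine ⟨hcl, fun p hp => ?_⟩
    obtain ⟨η, h1, h2⟩ := key p hp
    refine ⟨η, h1, h2, ?_⟩
    rw [← ha]
    exact congrArg Submodule.Quotient.mk (Subtype.ext h2)
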